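/- Let $\mathcal G$ be a non-empty ample groupoid, that is, a topological groupoid (viewed as its set of arrows, with objects identified with identity arrows) whose domain map $d\colon \mathcal G\to\mathcal G^0$ is a local homeomorphism and whose unit space $\mathcal G^0$ is locally compact, Hausdorff and has a basis of compact open sets; $\mathcal G$ itself need not be Hausdorff. Let $r$ denote the range map. For a field $K$, let $K\mathcal G$ be the Steinberg algebra of $\mathcal G$: the $K$-span in $K^{\mathcal G}$ of the characteristic functions of compact local bisections (compact open sets $U\subseteq\mathcal G$ such that $d|_U$ and $r|_U$ are homeomorphisms onto their images), with the convolution product $(f*g)(\gamma)=\sum_{\alpha\beta=\gamma}f(\alpha)g(\beta)$. Let $\mathrm{Sing}_K(\mathcal G)$ be the ideal of singular functions, i.e. of those $f\in K\mathcal G$ for which $\{\gamma: f(\gamma)\neq 0\}$ has empty interior. Then the essential algebra $K\mathcal G/\mathrm{Sing}_K(\mathcal G)$ is simple (it is non-zero and its only two-sided ideals are $0$ and itself) if and only if both of the following hold: (1) $\mathcal G$ is minimal: $\mathcal G^0$ has no proper, non-empty open subset that is invariant (a union of orbits); (2) $\mathcal G$ is topologically free: the set $\{g\in\mathcal G : d(g)=r(g)\}\setminus\mathcal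 G^0$ has empty interior in $\mathcal G$. In particular, simplicity does not depend on the field: for any two fields $K$ and $L$, $K\mathcal G/\mathrm{Sing}_K(\mathcal G)$ is simple if and only if $L\mathcal G/\mathrm{Sing}_L(\mathcal G)$ is simple. -/

import Mathlib

/-! Ample groupoids, their Steinberg algebras and their essential algebras.

A groupoid is viewed as its set of arrows; an object is identified with the identity at that
object. -/

universe u v w

namespace EtaleGroupoid

/-- A groupoid, presented as its set `G` of arrows with domain map `dom`, range map `ran`
(an object is identified with its identity arrow), inversion, and a product `mul g h` which is
defined exactly when `dom g = ran h`. -/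
class ArrowGroupoid (G : Type u) where
  dom : G → G
  ran : G → G
  mul : ∀ g h : G, dom g = ran h → G
  inv : G → G
  dom_dom : ∀ g, dom (dom g) = dom g
  ran_dom : ∀ g, ran (dom g) = dom g
  dom_ran : ∀ g, dom (ran g) = ran g
  ran_ran : ∀ g, ran (ran g) = ran g
  dom_mul : ∀ g h (e : dom g = ran h), dom (mul g h e) = dom h
  ran_mul : ∀ g h (e : dom g = ran h), ran (mul g h e) = ran g
  mul_assoc : ∀ g h k (e₁ : dom g = ran h) (e₂ : dom h = ran k)
    (e₃ : dom (mul g h e₁) = ran k) (e₄ : dom g = ran (mul h k e₂)),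
    mul (mul g h e₁) k e₃ = mul g (mul h k e₂) e₄
  mul_dom : ∀ g, mul g (dom g) (ran_dom g).symm = g
  ran_mul_self : ∀ g, mul (ran g) g (dom_ran g) = g
  dom_inv : ∀ g, dom (inv g) = ran g
  ran_inv : ∀ g, ran (inv g) = dom g
  inv_mul : ∀ g, mul (inv g) g (dom_inv g) = dom g
  mul_inv : ∀ g, mul g (inv g) (ran_inv g).symm = ran g

open ArrowGroupoid

section Algebraic

variable {G : Type u} [ArrowGroupoid G]

/-- `IsProd a b c`: the product `ab` is defined and equal to `c`. -/
def IsProd (a b c : G) : Prop := ∃ e : dom a = ran b, mul a b e = c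

variable (G) in
/-- The unit space: the set of identity arrows. -/
def unitSpace : Set G := {x | dom x = x}

/-- The domain map, as a map to the unit space. -/
def domMap (g : G) : unitSpace G := ⟨dom g, dom_dom g⟩

/-- The range map, as a map to the unit space. -/
def ranMap (g : G) : unitSpace G := ⟨ran g, dom_ran g⟩

/-- The orbit of a unit `x`. -/
def orbit (x : unitSpace G) : Set (unitSpace G) := {y | ∃ g : G, domMap g = x ∧ ranMap g = y}

/-- A set of units is invariant if it is a union of orbits. -/
def IsInvariant (X : Set (unitSpace G)) : Prop := ∀ x ∈ X, orbit x ⊆ X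

variable (G) in
/-- The isotropy subgroupoid. -/
def iso : Set G := {g | dom g = ran g}

/-- The product of two sets of arrows. -/
def setMul (U V : Set G) : Set G := {c | ∃ a ∈ U, ∃ b ∈ V, IsProd a b c}

theorem IsProd.unique {a b c c' : G} (h : IsProd a b c) (h' : IsProd a b c') : c = c' := by
  obtain ⟨e, rfl⟩ := h
  obtain ⟨e', rfl⟩ := h'
  rfl

theorem IsProd.dom_eq {a b c : G} (h : IsProd a b c) : dom c = dom b := by
  obtain ⟨e, rfl⟩ := h
  exact dom_mul _ _ _

theorem IsProd.ran_eq {a b c : G} (h : IsProd a b c) : ran c = ran a := by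
  obtain ⟨e, rfl⟩ := h
  exact ran_mul _ _ _

theorem isProd_of {a b : G} (e : dom a = ran b) : ∃ c, IsProd a b c := ⟨_, e, rfl⟩

theorem IsProd.assoc {a b c x y : G} (h : IsProd a b x) (h' : IsProd x c y) :
    ∃ z, IsProd b c z ∧ IsProd a z y := by
  obtain ⟨e, rfl⟩ := h
  obtain ⟨e', rfl⟩ := h'
  have e₂ : dom b = ran c := by rw [← dom_mul a b e, e']
  exact ⟨mul b c e₂, ⟨e₂, rfl⟩, by rw [ran_mul, e], (ArrowGroupoid.mul_assoc ..).symm⟩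

theorem IsProd.assoc_symm {a b c z y : G} (h : IsProd b c z) (h' : IsProd a z y) :
    ∃ x, IsProd a b x ∧ IsProd x c y := by
  obtain ⟨e, rfl⟩ := h
  obtain ⟨e', rfl⟩ := h'
  have e₂ : dom a = ran b := by rw [e', ran_mul]
  exact ⟨mul a b e₂, ⟨e₂, rfl⟩, by rw [dom_mul, e], ArrowGroupoid.mul_assoc ..⟩

theorem isProd_inv_self (g : G) : IsProd (inv g) g (dom g) := ⟨_, ArrowGroupoid.inv_mul g⟩

theorem isProd_self_inv (g : G) : IsProd g (inv g) (ran g) := ⟨_, ArrowGroupoid.mul_inv g⟩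

theorem isProd_dom (g : G) : IsProd g (dom g) g := ⟨_, ArrowGroupoid.mul_dom g⟩

theorem isProd_ran (g : G) : IsProd (ran g) g g := ⟨_, ArrowGroupoid.ran_mul_self g⟩

theorem inv_inv (g : G) : inv (inv g) = g := by
  have h1 := isProd_inv_self (inv g)
  rw [ArrowGroupoid.dom_inv] at h1
  obtain ⟨z, hz, hz'⟩ := h1.assoc (isProd_ran g)
  rw [hz.unique (isProd_inv_self g)] at hz'
  have h3 := isProd_dom (inv (inv g))
  rw [ArrowGroupoid.dom_inv, ArrowGroupoid.ran_inv] at h3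
  exact h3.unique hz'

theorem IsProd.left_inv {a b c : G} (h : IsProd a b c) : IsProd (inv a) c b := by
  obtain ⟨x, hx, hx'⟩ := h.assoc_symm
    (isProd_of (a := inv a) (by rw [ArrowGroupoid.dom_inv, h.ran_eq])).choose_spec
  have e : dom a = ran b := h.1
  have hx2 := hx.unique (isProd_inv_self a)
  rw [hx2, e] at hx'
  have := hx'.unique (isProd_ran b)
  have h' := (isProd_of (a := inv a) (b := c) (by rw [ArrowGroupoid.dom_inv, h.ran_eq])).choose_spec
  rwa [this] at h'

theorem IsProd.right_inv {a b c : G} (h : IsProd a b c) : IsProd c (inv b) a := by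
  obtain ⟨y, hy⟩ := isProd_of (a := c) (b := inv b) (by rw [ArrowGroupoid.ran_inv, h.dom_eq])
  obtain ⟨z, hz, hz'⟩ := h.assoc hy
  rw [hz.unique (isProd_self_inv b), ← h.1] at hz'
  rwa [hz'.unique (isProd_dom a)] at hy

theorem IsProd.inv_rev {a b c : G} (h : IsProd a b c) : IsProd (inv b) (inv a) (inv c) :=
  h.left_inv.right_inv.left_inv

theorem setMul_assoc (U V W : Set G) : setMul (setMul U V) W = setMul U (setMul V W) := by
  ext y
  constructor
  · rintro ⟨x, ⟨a, ha, b, hb, h⟩, c, hc, h'⟩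
    obtain ⟨z, hz, hz'⟩ := h.assoc h'
    exact ⟨a, ha, z, ⟨b, hb, c, hc, hz⟩, hz'⟩
  · rintro ⟨a, ha, z, ⟨b, hb, c, hc, h⟩, h'⟩
    obtain ⟨x, hx, hx'⟩ := h.assoc_symm h'
    exact ⟨x, ⟨a, ha, b, hb, hx⟩, c, hc, hx'⟩

theorem setMul_eq_inv (U V : Set G) :
    setMul U V = inv ⁻¹' setMul (inv ⁻¹' V) (inv ⁻¹' U) := by
  ext c
  constructor
  · rintro ⟨a, ha, b, hb, h⟩
    exact ⟨inv b, by simpa [inv_inv], inv a, by simpa [inv_inv], h.inv_rev⟩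
  · rintro ⟨b, hb, a, ha, h⟩
    exact ⟨inv a, ha, inv b, hb, by simpa [inv_inv] using h.inv_rev⟩

end Algebraic

section Topological

/-- A topological groupoid: all structure maps are continuous. The set of composable pairs has
the subspace topology of the product. -/
class IsTopologicalGroupoid (G : Type u) [ArrowGroupoid G] [TopologicalSpace G] : Prop where
  continuous_dom : Continuous (dom : G → G)
  continuous_ran : Continuous (ran : G → G)
  continuous_inv : Continuous (inv : G → G)
  continuous_mul :
    Continuous (fun p : {p : G × G // dom p.1 = ran p.2} => mul p.1.1 p.1.2 p.2)

/-- An étale groupoid: a topological groupoid whose domain map is a local homeomorphism onto the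
unit space, the latter being locally compact and Hausdorff (the groupoid need not be). -/
class IsEtale (G : Type u) [ArrowGroupoid G] [TopologicalSpace G] : Prop
    extends IsTopologicalGroupoid G where
  isLocalHomeomorph_dom : IsLocalHomeomorph (domMap : G → unitSpace G)
  t2Space_unitSpace : T2Space (unitSpace G)
  locallyCompactSpace_unitSpace : LocallyCompactSpace (unitSpace G)

/-- An ample groupoid: an étale groupoid whose unit space has a basis of compact open sets. -/
class IsAmple (G : Type u) [ArrowGroupoid G] [TopologicalSpace G] : Prop
    extends IsEtale G where
  isTopologicalBasis_compactOpen :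
    TopologicalSpace.IsTopologicalBasis {U : Set (unitSpace G) | IsOpen U ∧ IsCompact U}

variable {G : Type u} [ArrowGroupoid G] [TopologicalSpace G]

/-- A local bisection: an open set on which the domain and range maps are homeomorphisms onto
their images. -/
structure IsLocalBisection (U : Set G) : Prop where
  isOpen : IsOpen U
  isEmbedding_dom : Topology.IsEmbedding (fun g : U => domMap g.1)
  isEmbedding_ran : Topology.IsEmbedding (fun g : U => ranMap g.1)

variable (G) in
/-- Minimality: the unit space has no proper, non-empty, open invariant subset. -/
def IsMinimal : Prop :=
  ∀ X : Set (unitSpace G), IsOpen X → IsInvariant X → X = ∅ ∨ X = Set.univ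

variable (G) in
/-- Topological freeness: `Iso(G) \ G⁰` has empty interior. -/
def IsTopologicallyFree : Prop := interior (iso G \ unitSpace G) = ∅

theorem IsLocalBisection.injOn_dom {U : Set G} (hU : IsLocalBisection U) : Set.InjOn dom U := by
  intro a ha b hb h
  exact congrArg Subtype.val
    (hU.isEmbedding_dom.injective (a₁ := ⟨a, ha⟩) (a₂ := ⟨b, hb⟩) (Subtype.ext h))

theorem IsLocalBisection.injOn_ran {U : Set G} (hU : IsLocalBisection U) : Set.InjOn ran U := by
  intro a ha b hb h
  exact congrArg Subtype.val
    (hU.isEmbedding_ran.injective (a₁ := ⟨a, ha⟩) (a₂ := ⟨b, hb⟩) (Subtype.ext h))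

section Etale

variable [IsEtale G]

theorem continuous_inv : Continuous (inv : G → G) := IsTopologicalGroupoid.continuous_inv

variable (G) in
/-- Inversion as a homeomorphism. -/
def invHomeo : G ≃ₜ G where
  toFun := inv
  invFun := inv
  left_inv := inv_inv
  right_inv := inv_inv
  continuous_toFun := continuous_inv
  continuous_invFun := continuous_inv

theorem isLocalHomeomorph_ran : IsLocalHomeomorph (ranMap : G → unitSpace G) := by
  have h : (ranMap : G → unitSpace G) = domMap ∘ (invHomeo G) := by
    funext g
    exact Subtype.ext (ArrowGroupoid.dom_inv g).symm
  rw [h]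
  exact IsEtale.isLocalHomeomorph_dom.comp (invHomeo G).isLocalHomeomorph

theorem isLocalBisection_of_injOn {U : Set G} (hU : IsOpen U) (hd : Set.InjOn dom U)
    (hr : Set.InjOn ran U) : IsLocalBisection U := by
  have hv : IsLocalHomeomorph (Subtype.val : U → G) := hU.isOpenEmbedding_subtypeVal.isLocalHomeomorph
  refine ⟨hU, ?_, ?_⟩
  · refine ((IsEtale.isLocalHomeomorph_dom.comp hv).isOpenEmbedding_of_injective ?_).isEmbedding
    rintro ⟨a, ha⟩ ⟨b, hb⟩ h
    exact Subtype.ext (hd ha hb (congrArg Subtype.val h))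
  · refine ((isLocalHomeomorph_ran.comp hv).isOpenEmbedding_of_injective ?_).isEmbedding
    rintro ⟨a, ha⟩ ⟨b, hb⟩ h
    exact Subtype.ext (hr ha hb (congrArg Subtype.val h))

theorem IsLocalBisection.preimage_inv {U : Set G} (hU : IsLocalBisection U) :
    IsLocalBisection (inv ⁻¹' U) := by
  refine isLocalBisection_of_injOn (hU.isOpen.preimage continuous_inv) ?_ ?_
  · intro a ha b hb h
    rw [← inv_inv a, ← inv_inv b, hU.injOn_ran ha hb]
    rw [ArrowGroupoid.ran_inv, ArrowGroupoid.ran_inv, h]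
  · intro a ha b hb h
    rw [← inv_inv a, ← inv_inv b, hU.injOn_dom ha hb]
    rw [ArrowGroupoid.dom_inv, ArrowGroupoid.dom_inv, h]

theorem isOpen_setMul_left {U V : Set G} (hU : IsLocalBisection U) (hV : IsOpen V) :
    IsOpen (setMul U V) := by
  let φ : U → unitSpace G := fun g => ranMap g.1
  have hrange : IsOpen (Set.range φ) := by
    have : Set.range φ = ranMap '' U := by
      ext x
      simp [φ]
    rw [this]
    exact isLocalHomeomorph_ran.isOpenMap _ hU.isOpen
  let e : U ≃ₜ Set.range φ := hU.isEmbedding_ran.toHomeomorph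
  let A : Set G := ranMap ⁻¹' Set.range φ
  have hA : IsOpen A := hrange.preimage isLocalHomeomorph_ran.continuous
  let σ : A → U := fun a => e.symm ⟨ranMap a.1, a.2⟩
  have hσ : Continuous σ := e.symm.continuous.comp
    ((isLocalHomeomorph_ran.continuous.comp continuous_subtype_val).subtype_mk _)
  have hσr : ∀ a, ran (σ a).1 = ran a.1 := by
    intro a
    have h : e (σ a) = ⟨ranMap a.1, a.2⟩ := e.apply_symm_apply _
    exact congrArg (fun z => (z.1 : G)) h
  have hcomp : ∀ a : A, dom (inv (σ a).1) = ran a.1 := fun a => by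
    rw [ArrowGroupoid.dom_inv, hσr]
  let τ : A → G := fun a => mul (inv (σ a).1) a.1 (hcomp a)
  have hτ : Continuous τ := by
    have h2 : Continuous (fun a : A =>
        (⟨(inv (σ a).1, a.1), hcomp a⟩ : {p : G × G // dom p.1 = ran p.2})) :=
      ((continuous_inv.comp (continuous_subtype_val.comp hσ)).prodMk
        continuous_subtype_val).subtype_mk _
    exact (IsTopologicalGroupoid.continuous_mul (G := G)).comp h2
  have hτp : ∀ a, IsProd (inv (σ a).1) a.1 (τ a) := fun a => ⟨hcomp a, rfl⟩
  have key : setMul U V = Subtype.val '' (τ ⁻¹' V) := by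
    ext c
    constructor
    · rintro ⟨a, ha, b, hb, h⟩
      have hc : c ∈ A := ⟨⟨a, ha⟩, Subtype.ext h.ran_eq.symm⟩
      refine ⟨⟨c, hc⟩, ?_, rfl⟩
      have ha' : (σ ⟨c, hc⟩).1 = a :=
        hU.injOn_ran (σ ⟨c, hc⟩).2 ha ((hσr ⟨c, hc⟩).trans h.ran_eq)
      have h1 := hτp ⟨c, hc⟩
      rw [ha'] at h1
      change τ ⟨c, hc⟩ ∈ V
      rw [h1.unique h.left_inv]
      exact hb
    · rintro ⟨a, ha, rfl⟩
      refine ⟨(σ a).1, (σ a).2, τ a, ha, ?_⟩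
      simpa [inv_inv] using (hτp a).left_inv
  rw [key]
  exact hA.isOpenMap_subtype_val _ (hV.preimage hτ)

theorem isOpen_setMul_right {U V : Set G} (hU : IsOpen U) (hV : IsLocalBisection V) :
    IsOpen (setMul U V) := by
  rw [setMul_eq_inv]
  exact (isOpen_setMul_left hV.preimage_inv (hU.preimage continuous_inv)).preimage continuous_inv

theorem IsLocalBisection.setMul {U V : Set G} (hU : IsLocalBisection U)
    (hV : IsLocalBisection V) : IsLocalBisection (setMul U V) := by
  refine isLocalBisection_of_injOn (isOpen_setMul_left hU hV.isOpen) ?_ ?_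
  · rintro c ⟨a, ha, b, hb, h⟩ c' ⟨a', ha', b', hb', h'⟩ hc
    have e1 : b = b' := hV.injOn_dom hb hb' (by rw [← h.dom_eq, ← h'.dom_eq, hc])
    subst e1
    have e2 : a = a' := hU.injOn_dom ha ha' (by rw [h.1, h'.1])
    subst e2
    exact h.unique h'
  · rintro c ⟨a, ha, b, hb, h⟩ c' ⟨a', ha', b', hb', h'⟩ hc
    have e1 : a = a' := hU.injOn_ran ha ha' (by rw [← h.ran_eq, ← h'.ran_eq, hc])
    subst e1
    have e2 : b = b' := hV.injOn_ran hb hb' (by rw [← h.1, ← h'.1])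
    subst e2
    exact h.unique h'

theorem isCompact_setMul {U V : Set G} (hU : IsCompact U) (hV : IsCompact V) :
    IsCompact (setMul U V) := by
  have : T2Space (unitSpace G) := IsEtale.t2Space_unitSpace
  have hclosed : IsClosed {p : G × G | dom p.1 = ran p.2} := by
    have h : {p : G × G | dom p.1 = ran p.2} = {p : G × G | domMap p.1 = ranMap p.2} := by
      ext p
      exact ⟨fun h => Subtype.ext h, fun h => congrArg Subtype.val h⟩
    rw [h]
    exact isClosed_eq (IsEtale.isLocalHomeomorph_dom.continuous.comp continuous_fst)
      (isLocalHomeomorph_ran.continuous.comp continuous_snd)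
  have hK : IsCompact ((U ×ˢ V) ∩ {p : G × G | dom p.1 = ran p.2}) :=
    (hU.prod hV).inter_right hclosed
  have hK' : IsCompact ((Subtype.val : {p : G × G // dom p.1 = ran p.2} → G × G) ⁻¹' (U ×ˢ V)) := by
    rw [Subtype.isCompact_iff]
    convert hK using 1
    ext p
    constructor
    · rintro ⟨q, hq, rfl⟩
      exact ⟨hq, q.2⟩
    · rintro ⟨hp, hp'⟩
      exact ⟨⟨p, hp'⟩, hp, rfl⟩
  convert hK'.image (IsTopologicalGroupoid.continuous_mul (G := G)) using 1
  ext c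
  constructor
  · rintro ⟨a, ha, b, hb, e, rfl⟩
    exact ⟨⟨(a, b), e⟩, ⟨ha, hb⟩, rfl⟩
  · rintro ⟨⟨⟨a, b⟩, e⟩, ⟨ha, hb⟩, rfl⟩
    exact ⟨a, ha, b, hb, e, rfl⟩

end Etale

end Topological

section Convolution

variable {K : Type v} [CommRing K] {G : Type u} [ArrowGroupoid G]

/-- The set of factorizations `c = ab`. -/
abbrev Factor (c : G) : Type u := {p : G × G // IsProd p.1 p.2 c}

/-- Convolution: `(f * g)(c)` is the sum of `f a * g b` over all factorizations `c = ab`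
(a finite sum for elements of the Steinberg algebra). -/
noncomputable def conv (f g : G → K) (c : G) : K := ∑ᶠ p : Factor c, f p.1.1 * g p.1.2

variable (K) in
/-- The characteristic function of a set of arrows. -/
noncomputable def char (U : Set G) : G → K := U.indicator (fun _ => 1)

/-- Finitely many non-zero terms in every convolution with `f` on the left. -/
def FiberFinite (f : G → K) : Prop := ∀ c, {p : Factor c | f p.1.1 ≠ 0}.Finite

theorem FiberFinite.support {f : G → K} (hf : FiberFinite f) (g : G → K) (c : G) :
    (Function.support fun p : Factor c => f p.1.1 * g p.1.2).Finite :=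
  (hf c).subset fun _ hp h => hp (by simp [h])

theorem conv_add_left {f₁ f₂ g : G → K} (h₁ : FiberFinite f₁) (h₂ : FiberFinite f₂) :
    conv (f₁ + f₂) g = conv f₁ g + conv f₂ g := by
  funext c
  simp only [conv, Pi.add_apply, add_mul]
  exact finsum_add_distrib (h₁.support g c) (h₂.support g c)

theorem conv_add_right {f g₁ g₂ : G → K} (hf : FiberFinite f) :
    conv f (g₁ + g₂) = conv f g₁ + conv f g₂ := by
  funext c
  simp only [conv, Pi.add_apply, mul_add]
  exact finsum_add_distrib (hf.support g₁ c) (hf.support g₂ c)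

theorem conv_smul_left {f g : G → K} (hf : FiberFinite f) (r : K) :
    conv (r • f) g = r • conv f g := by
  funext c
  simp only [conv, Pi.smul_apply, smul_mul_assoc]
  exact (smul_finsum' r (hf.support g c)).symm

theorem conv_smul_right {f g : G → K} (hf : FiberFinite f) (r : K) :
    conv f (r • g) = r • conv f g := by
  funext c
  simp only [conv, Pi.smul_apply, mul_smul_comm]
  exact (smul_finsum' r (hf.support g c)).symm

@[simp] theorem conv_zero_left (g : G → K) : conv 0 g = 0 := by
  funext c
  simp [conv]

@[simp] theorem conv_zero_right (g : G → K) : conv g 0 = 0 := by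
  funext c
  simp [conv]

theorem fiberFinite_char {U : Set G} (hU : Set.InjOn ran U) : FiberFinite (char K U) := by
  intro c
  refine Set.Subsingleton.finite ?_
  rintro ⟨⟨a, b⟩, h⟩ hp ⟨⟨a', b'⟩, h'⟩ hp'
  have ha : a ∈ U := Set.mem_of_indicator_ne_zero hp
  have ha' : a' ∈ U := Set.mem_of_indicator_ne_zero hp'
  have e1 : a = a' := hU ha ha' (by rw [← h.ran_eq, ← h'.ran_eq])
  subst e1
  have e2 : b = b' := h.left_inv.unique h'.left_inv
  subst e2
  rfl

theorem FiberFinite.add {f g : G → K} (hf : FiberFinite f) (hg : FiberFinite g) :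
    FiberFinite (f + g) := by
  intro c
  refine ((hf c).union (hg c)).subset fun p hp => ?_
  by_contra h
  simp only [Set.mem_union, Set.mem_ofPred_eq, not_or, not_not] at h
  exact hp (by simp [h.1, h.2])

theorem FiberFinite.smul {f : G → K} (hf : FiberFinite f) (r : K) : FiberFinite (r • f) := by
  intro c
  exact (hf c).subset fun p hp h => hp (by simp [h])

theorem conv_char_left {U : Set G} (hU : Set.InjOn ran U) (g : G → K) {a b c : G} (ha : a ∈ U)
    (h : IsProd a b c) : conv (char K U) g c = g b := by
  unfold conv
  rw [finsum_eq_single _ (⟨(a, b), h⟩ : Factor c)]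
  · simp [char, ha]
  · rintro ⟨⟨a', b'⟩, h'⟩ hne
    by_cases ha' : a' ∈ U
    · exfalso
      apply hne
      have e1 : a' = a := hU ha' ha (by rw [← h.ran_eq, ← h'.ran_eq])
      subst e1
      have e2 : b' = b := h'.left_inv.unique h.left_inv
      subst e2
      rfl
    · simp [char, ha']

theorem conv_char_right {U : Set G} (hU : Set.InjOn dom U) (f : G → K) {a b c : G} (hb : b ∈ U)
    (h : IsProd a b c) : conv f (char K U) c = f a := by
  unfold conv
  rw [finsum_eq_single _ (⟨(a, b), h⟩ : Factor c)]
  · simp [char, hb]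
  · rintro ⟨⟨a', b'⟩, h'⟩ hne
    by_cases hb' : b' ∈ U
    · exfalso
      apply hne
      have e1 : b' = b := hU hb' hb (by rw [← h.dom_eq, ← h'.dom_eq])
      subst e1
      have e2 : a' = a := h'.right_inv.unique h.right_inv
      subst e2
      rfl
    · simp [char, hb']

theorem exists_of_conv_char_left_ne {U : Set G} {g : G → K} {c : G}
    (h : conv (char K U) g c ≠ 0) : ∃ a ∈ U, ∃ b, IsProd a b c := by
  by_contra hn
  push Not at hn
  apply h
  refine finsum_eq_zero_of_forall_eq_zero fun p => ?_
  have : p.1.1 ∉ U := fun hp => hn _ hp _ p.2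
  simp [char, this]

theorem exists_of_conv_char_right_ne {U : Set G} {f : G → K} {c : G}
    (h : conv f (char K U) c ≠ 0) : ∃ b ∈ U, ∃ a, IsProd a b c := by
  by_contra hn
  push Not at hn
  apply h
  refine finsum_eq_zero_of_forall_eq_zero fun p => ?_
  have : p.1.2 ∉ U := fun hp => hn _ hp _ p.2
  simp [char, this]

theorem conv_char_char {U V : Set G} (hU : Set.InjOn ran U) :
    conv (char K U) (char K V) = char K (setMul U V) := by
  funext c
  by_cases hc : ∃ a ∈ U, ∃ b, IsProd a b c
  · obtain ⟨a, ha, b, h⟩ := hc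
    rw [conv_char_left hU _ ha h]
    have : c ∈ setMul U V ↔ b ∈ V := by
      constructor
      · rintro ⟨a', ha', b', hb', h'⟩
        have e1 : a' = a := hU ha' ha (by rw [← h.ran_eq, ← h'.ran_eq])
        subst e1
        rwa [h.left_inv.unique h'.left_inv]
      · exact fun hb => ⟨a, ha, b, hb, h⟩
    by_cases hb : b ∈ V
    · simp [char, hb, this.2 hb]
    · simp [char, hb, mt this.1 hb]
  · have h0 : conv (char K U) (char K V) c = 0 := by
      by_contra h
      exact hc (exists_of_conv_char_left_ne h)
    rw [h0]
    have : c ∉ setMul U V := fun ⟨a, ha, b, _, h⟩ => hc ⟨a, ha, b, h⟩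
    simp [char, this]

end Convolution

section Steinberg

variable (K : Type v) [CommRing K] (G : Type u) [ArrowGroupoid G] [TopologicalSpace G]

/-- The `K`-span of the characteristic functions of compact local bisections. -/
def steinbergSubmodule : Submodule K (G → K) :=
  Submodule.span K {f | ∃ U : Set G, IsLocalBisection U ∧ IsCompact U ∧ f = char K U}

/-- The Steinberg algebra `KG`; its multiplication is convolution. -/
def SteinbergAlgebra : Type (max u v) := steinbergSubmodule K G

noncomputable instance : AddCommGroup (SteinbergAlgebra K G) :=
  inferInstanceAs (AddCommGroup (steinbergSubmodule K G))

noncomputable instance : Module K (SteinbergAlgebra K G) :=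
  inferInstanceAs (Module K (steinbergSubmodule K G))

variable {K G}

theorem fiberFinite_of_mem {f : G → K} (hf : f ∈ steinbergSubmodule K G) : FiberFinite f := by
  induction hf using Submodule.span_induction with
  | mem f h =>
    obtain ⟨U, hU, -, rfl⟩ := h
    exact fiberFinite_char hU.injOn_ran
  | zero => intro c; simp
  | add f g _ _ hf hg => exact hf.add hg
  | smul r f _ hf => exact hf.smul r

theorem conv_mem [IsAmple G] {f g : G → K} (hf : f ∈ steinbergSubmodule K G)
    (hg : g ∈ steinbergSubmodule K G) : conv f g ∈ steinbergSubmodule K G := by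
  induction hf using Submodule.span_induction with
  | mem f h =>
    obtain ⟨U, hU, hUc, rfl⟩ := h
    have hff := fiberFinite_char (K := K) hU.injOn_ran
    induction hg using Submodule.span_induction with
    | mem g h =>
      obtain ⟨V, hV, hVc, rfl⟩ := h
      rw [conv_char_char hU.injOn_ran]
      exact Submodule.subset_span ⟨_, hU.setMul hV, isCompact_setMul hUc hVc, rfl⟩
    | zero => simp
    | add g₁ g₂ _ _ h₁ h₂ => rw [conv_add_right hff]; exact add_mem h₁ h₂
    | smul r g _ h => rw [conv_smul_right hff]; exact Submodule.smul_mem _ r h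
  | zero => simp
  | add f₁ f₂ m₁ m₂ h₁ h₂ =>
    rw [conv_add_left (fiberFinite_of_mem m₁) (fiberFinite_of_mem m₂)]
    exact add_mem h₁ h₂
  | smul r f m h =>
    rw [conv_smul_left (fiberFinite_of_mem m)]
    exact Submodule.smul_mem _ r h

theorem conv_assoc [IsAmple G] {f g k : G → K} (hf : f ∈ steinbergSubmodule K G)
    (hg : g ∈ steinbergSubmodule K G) (hk : k ∈ steinbergSubmodule K G) :
    conv (conv f g) k = conv f (conv g k) := by
  have ff : ∀ {f : G → K}, f ∈ steinbergSubmodule K G → FiberFinite f := fiberFinite_of_mem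
  induction hf using Submodule.span_induction with
  | zero => simp
  | add f₁ f₂ m₁ m₂ h₁ h₂ =>
    rw [conv_add_left (ff m₁) (ff m₂), conv_add_left (ff m₁) (ff m₂),
      conv_add_left (ff (conv_mem m₁ hg)) (ff (conv_mem m₂ hg)), h₁, h₂]
  | smul r f m h =>
    rw [conv_smul_left (ff m), conv_smul_left (ff m), conv_smul_left (ff (conv_mem m hg)), h]
  | mem f h =>
    have hf : f ∈ steinbergSubmodule K G := Submodule.subset_span h
    obtain ⟨U, hU, -, rfl⟩ := h
    induction hg using Submodule.span_induction with
    | zero => simp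
    | add g₁ g₂ m₁ m₂ h₁ h₂ =>
      rw [conv_add_right (ff hf), conv_add_left (ff m₁) (ff m₂),
        conv_add_left (ff (conv_mem hf m₁)) (ff (conv_mem hf m₂)), conv_add_right (ff hf), h₁, h₂]
    | smul r g m h =>
      rw [conv_smul_right (ff hf), conv_smul_left (ff m), conv_smul_left (ff (conv_mem hf m)),
        conv_smul_right (ff hf), h]
    | mem g h =>
      have hg : g ∈ steinbergSubmodule K G := Submodule.subset_span h
      obtain ⟨V, hV, -, rfl⟩ := h
      induction hk using Submodule.span_induction with
      | zero => simp
      | add k₁ k₂ m₁ m₂ h₁ h₂ =>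
        rw [conv_add_right (ff hg), conv_add_right (ff hf),
          conv_add_right (ff (conv_mem hf hg)), h₁, h₂]
      | smul r k m h =>
        rw [conv_smul_right (ff hg), conv_smul_right (ff hf),
          conv_smul_right (ff (conv_mem hf hg)), h]
      | mem k h =>
        obtain ⟨W, hW, -, rfl⟩ := h
        rw [conv_char_char hU.injOn_ran, conv_char_char (hU.setMul hV).injOn_ran,
          conv_char_char hV.injOn_ran, conv_char_char hU.injOn_ran, setMul_assoc]

variable [IsAmple G]

noncomputable instance : NonUnitalRing (SteinbergAlgebra K G) :=
  { (inferInstance : AddCommGroup (SteinbergAlgebra K G)) with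
    mul := fun f g => ⟨conv f.1 g.1, conv_mem f.2 g.2⟩
    left_distrib := fun f _ _ => Subtype.ext (conv_add_right (fiberFinite_of_mem f.2))
    right_distrib := fun f g _ =>
      Subtype.ext (conv_add_left (fiberFinite_of_mem f.2) (fiberFinite_of_mem g.2))
    zero_mul := fun _ => Subtype.ext (conv_zero_left _)
    mul_zero := fun _ => Subtype.ext (conv_zero_right _)
    mul_assoc := fun f g k => Subtype.ext (conv_assoc f.2 g.2 k.2) }

instance : IsScalarTower K (SteinbergAlgebra K G) (SteinbergAlgebra K G) :=
  ⟨fun r f _ => Subtype.ext (conv_smul_left (fiberFinite_of_mem f.2) r)⟩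

instance : SMulCommClass K (SteinbergAlgebra K G) (SteinbergAlgebra K G) :=
  ⟨fun r f _ => Subtype.ext (conv_smul_right (fiberFinite_of_mem f.2) r).symm⟩

end Steinberg

section Singular

variable {K : Type v} [CommRing K] {G : Type u} [TopologicalSpace G]

/-- A function is singular if its support (no closure taken) has empty interior. -/
def IsSingular (f : G → K) : Prop := interior (Function.support f) = ∅

theorem isSingular_of_dense {f : G → K} {D : Set G} (hD : Dense D) (h : ∀ x ∈ D, f x = 0) :
    IsSingular f := by
  rw [IsSingular, interior_eq_empty_iff_dense_compl]
  exact hD.mono fun x hx hx' => hx' (h x hx)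

theorem isSingular_zero : IsSingular (0 : G → K) := by simp [IsSingular]

theorem IsSingular.smul {f : G → K} (hf : IsSingular f) (r : K) : IsSingular (r • f) := by
  have hsub : Function.support (r • f) ⊆ Function.support f := by
    intro x hx h
    exact hx (by simp [h])
  exact Set.subset_empty_iff.1 ((interior_mono hsub).trans hf.subset)

variable [ArrowGroupoid G]

/-- An element of the Steinberg algebra is locally constant on a dense open set. -/
theorem exists_dense_of_mem {f : G → K} (hf : f ∈ steinbergSubmodule K G) :
    ∃ D : Set G, IsOpen D ∧ Dense D ∧ ∀ x ∈ D, ∀ᶠ y in nhds x, f y = f x := by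
  induction hf using Submodule.span_induction with
  | mem f h =>
    obtain ⟨U, hU, -, rfl⟩ := h
    refine ⟨(frontier U)ᶜ, isClosed_frontier.isOpen_compl,
      interior_eq_empty_iff_dense_compl.1 (by rw [← frontier_compl]; exact interior_frontier hU.isOpen.isClosed_compl), fun x hx => ?_⟩
    by_cases hxU : x ∈ U
    · filter_upwards [hU.isOpen.mem_nhds hxU] with y hy
      simp [char, hxU, hy]
    · have hx' : x ∉ closure U := fun h => hx ⟨h, by rwa [hU.isOpen.interior_eq]⟩
      filter_upwards [isClosed_closure.isOpen_compl.mem_nhds hx'] with y hy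
      have : y ∉ U := fun h => hy (subset_closure h)
      simp [char, hxU, this]
  | zero => exact ⟨Set.univ, isOpen_univ, dense_univ, by simp⟩
  | add f g _ _ hf hg =>
    obtain ⟨D, hD, hDd, hf⟩ := hf
    obtain ⟨E, hE, hEd, hg⟩ := hg
    refine ⟨D ∩ E, hD.inter hE, hDd.inter_of_isOpen_left hEd hD, fun x hx => ?_⟩
    filter_upwards [hf x hx.1, hg x hx.2] with y h1 h2
    simp [h1, h2]
  | smul r f _ hf =>
    obtain ⟨D, hD, hDd, hf⟩ := hf
    refine ⟨D, hD, hDd, fun x hx => ?_⟩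
    filter_upwards [hf x hx] with y h1
    simp [h1]

theorem IsSingular.exists_dense {f : G → K} (hf : f ∈ steinbergSubmodule K G)
    (hs : IsSingular f) : ∃ D : Set G, IsOpen D ∧ Dense D ∧ ∀ x ∈ D, f x = 0 := by
  obtain ⟨D, hD, hDd, h⟩ := exists_dense_of_mem hf
  refine ⟨D, hD, hDd, fun x hx => ?_⟩
  by_contra hne
  have : x ∈ interior (Function.support f) := by
    rw [mem_interior_iff_mem_nhds]
    filter_upwards [h x hx] with y hy
    rw [Function.mem_support, hy]
    exact hne
  rw [hs] at this
  exact this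

theorem IsSingular.add {f g : G → K} (mf : f ∈ steinbergSubmodule K G)
    (mg : g ∈ steinbergSubmodule K G) (hf : IsSingular f) (hg : IsSingular g) :
    IsSingular (f + g) := by
  obtain ⟨D, hD, hDd, h⟩ := hf.exists_dense mf
  obtain ⟨E, hE, hEd, h'⟩ := hg.exists_dense mg
  exact isSingular_of_dense (hDd.inter_of_isOpen_left hEd hD)
    fun x hx => by simp [h x hx.1, h' x hx.2]

variable [IsAmple G]

theorem IsSingular.char_conv {U : Set G} (hU : IsLocalBisection U) {f : G → K}
    (hf : IsSingular f) : IsSingular (conv (char K U) f) := by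
  rw [IsSingular, Set.eq_empty_iff_forall_notMem]
  intro w hw
  set W := interior (Function.support (conv (char K U) f)) with hW
  have hsub : setMul (inv ⁻¹' U) W ⊆ Function.support f := by
    rintro b ⟨a, ha, c, hc, h⟩
    have h' : IsProd (inv a) b c := h.left_inv
    have hc' : conv (char K U) f c ≠ 0 := interior_subset hc
    rwa [conv_char_left hU.injOn_ran f ha h'] at hc'
  have hopen : IsOpen (setMul (inv ⁻¹' U) W) :=
    isOpen_setMul_left hU.preimage_inv isOpen_interior
  obtain ⟨a, ha, b, h⟩ := exists_of_conv_char_left_ne (interior_subset hw)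
  have hb : b ∈ setMul (inv ⁻¹' U) W :=
    ⟨inv a, by simpa [inv_inv] using ha, w, hw, h.left_inv⟩
  have := interior_maximal hsub hopen hb
  rw [hf] at this
  exact this

theorem IsSingular.conv_char {U : Set G} (hU : IsLocalBisection U) {f : G → K}
    (hf : IsSingular f) : IsSingular (conv f (char K U)) := by
  rw [IsSingular, Set.eq_empty_iff_forall_notMem]
  intro w hw
  set W := interior (Function.support (conv f (char K U))) with hW
  have hsub : setMul W (inv ⁻¹' U) ⊆ Function.support f := by
    rintro a ⟨c, hc, b, hb, h⟩
    have h' : IsProd a (inv b) c := h.right_inv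
    have hc' : conv f (char K U) c ≠ 0 := interior_subset hc
    rwa [conv_char_right hU.injOn_dom f hb h'] at hc'
  have hopen : IsOpen (setMul W (inv ⁻¹' U)) :=
    isOpen_setMul_right isOpen_interior hU.preimage_inv
  obtain ⟨b, hb, a, h⟩ := exists_of_conv_char_right_ne (interior_subset hw)
  have ha : a ∈ setMul W (inv ⁻¹' U) :=
    ⟨w, hw, inv b, by simpa [inv_inv] using hb, h.right_inv⟩
  have := interior_maximal hsub hopen ha
  rw [hf] at this
  exact this

theorem IsSingular.conv_left {f g : G → K} (mf : f ∈ steinbergSubmodule K G)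
    (mg : g ∈ steinbergSubmodule K G) (hg : IsSingular g) : IsSingular (conv f g) := by
  induction mf using Submodule.span_induction with
  | mem f h =>
    obtain ⟨U, hU, -, rfl⟩ := h
    exact hg.char_conv hU
  | zero => simpa using isSingular_zero
  | add f₁ f₂ m₁ m₂ h₁ h₂ =>
    rw [conv_add_left (fiberFinite_of_mem m₁) (fiberFinite_of_mem m₂)]
    exact h₁.add (conv_mem m₁ mg) (conv_mem m₂ mg) h₂
  | smul r f m h =>
    rw [conv_smul_left (fiberFinite_of_mem m)]
    exact h.smul r

theorem IsSingular.conv_right {f g : G → K} (mf : f ∈ steinbergSubmodule K G)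
    (mg : g ∈ steinbergSubmodule K G) (hf : IsSingular f) : IsSingular (conv f g) := by
  have ff := fiberFinite_of_mem mf
  induction mg using Submodule.span_induction with
  | mem g h =>
    obtain ⟨U, hU, -, rfl⟩ := h
    exact hf.conv_char hU
  | zero => simpa using isSingular_zero
  | add g₁ g₂ m₁ m₂ h₁ h₂ =>
    rw [conv_add_right ff]
    exact h₁.add (conv_mem mf m₁) (conv_mem mf m₂) h₂
  | smul r g m h =>
    rw [conv_smul_right ff]
    exact h.smul r

variable (K G)

/-- The two-sided ideal of singular functions in the Steinberg algebra. -/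
noncomputable def singularIdeal : TwoSidedIdeal (SteinbergAlgebra K G) :=
  TwoSidedIdeal.mk' {f | IsSingular f.1}
    isSingular_zero
    (fun {f g} hf hg => IsSingular.add f.2 g.2 hf hg)
    (fun {f} hf => by
      have h := IsSingular.smul hf (-1)
      rw [neg_one_smul] at h
      exact h)
    (fun {f g} hg => IsSingular.conv_left f.2 g.2 hg)
    (fun {f g} hf => IsSingular.conv_right f.2 g.2 hf)

variable {K G} in
theorem mem_singularIdeal {f : SteinbergAlgebra K G} :
    f ∈ singularIdeal K G ↔ IsSingular f.1 :=
  TwoSidedIdeal.mem_mk' {f : SteinbergAlgebra K G | IsSingular f.1} _ _ _ _ _ f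

/-- The essential algebra: the quotient of the Steinberg algebra by the singular functions. -/
abbrev EssentialAlgebra : Type (max u v) := (singularIdeal K G).ringCon.Quotient

noncomputable instance : SMul K (EssentialAlgebra K G) :=
  ⟨(singularIdeal K G).ringCon.smulAux fun r f g h => by
    rw [TwoSidedIdeal.rel_iff] at h ⊢
    rw [← smul_sub]
    rw [mem_singularIdeal] at h ⊢
    exact IsSingular.smul h r⟩

noncomputable instance : Module K (EssentialAlgebra K G) :=
  Function.Surjective.module K
    (⟨⟨fun f => (f : EssentialAlgebra K G), rfl⟩, fun _ _ => rfl⟩ :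
      SteinbergAlgebra K G →+ EssentialAlgebra K G)
    Quotient.mk_surjective (fun _ _ => rfl)

end Singular

end EtaleGroupoid

/-! Write `S` for the ideal of singular functions. Simplicity of the quotient makes every ideal `I`
of the Steinberg algebra satisfy `I ≤ S` or `I + S = ⊤`
(`le_or_forall_exists_sub_mem_of_isSimpleRing`). Each necessary condition is obtained by exhibiting
an ideal that does neither when the condition fails.

Minimality: for an open invariant `X` that is neither empty nor everything, take the functions
supported over a compact subset of `X` (`invariantIdeal`). This ideal contains the characteristic
function of a compact open subset of `X`, which is not singular, but it cannot approximate modulo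
`S` the characteristic function of a neighbourhood of a unit outside `X`.

Topological freeness: the algebra acts on functions on the unit space, a bisection acting as a
partial homeomorphism. If a compact bisection `U` consists of non-unit isotropy, then `U` and `d(U)`
act alike, so `1_U - 1_{d(U)}` is a non-singular element of `actionKernel`. If also `actionKernel +
S = ⊤`, then `1_{d(U)}` acts as a singular function; by `IsSingular.exists_dense_ranMap` a singular
function acts by zero at a dense set of units, while `1_{d(U)}` fixes the value of every function at
each unit of `d(U)`.

Conversely, let `I` contain a non-singular function. A translate of it has value 1 on an open set of
units. Under topological freeness every Steinberg function, compressed to a small neighbourhood of a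
generic unit, becomes a multiple of the characteristic function of that neighbourhood
(`exists_dense_locally_unit`). So `I` contains `1_O` for some non-empty compact open `O` of units.
The union of all such `O` is open, and invariant because bisections conjugate them; by minimality it
is the whole unit space, and then `I` contains a left unit for each function.

The groupoid need not be Hausdorff, so separation and closedness arguments are carried out in the
Hausdorff unit space, through the domain and range maps. -/

namespace EtaleGroupoid

open ArrowGroupoid Topology

/-! ### Ideals of a ring and of its quotient -/

section QuotientIdeals

variable {R : Type*} [NonUnitalRing R]

/-- A two-sided ideal of `R` either lies in `S` or is complementary to it, when `R ⧸ S` is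
simple. -/
theorem le_or_forall_exists_sub_mem_of_isSimpleRing {S : TwoSidedIdeal R}
    [IsSimpleRing S.ringCon.Quotient] (I : TwoSidedIdeal R) :
    I ≤ S ∨ ∀ a, ∃ f ∈ I, a - f ∈ S := by
  -- The image of `I`, which is an ideal because the quotient map is surjective.
  let J : TwoSidedIdeal S.ringCon.Quotient := TwoSidedIdeal.mk'
    {q | ∃ f ∈ I, (f : S.ringCon.Quotient) = q}
    ⟨0, I.zero_mem, rfl⟩
    (by rintro _ _ ⟨f, hf, rfl⟩ ⟨g, hg, rfl⟩; exact ⟨f + g, I.add_mem hf hg, rfl⟩)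
    (by rintro _ ⟨f, hf, rfl⟩; exact ⟨-f, I.neg_mem hf, rfl⟩)
    (by
      rintro x _ ⟨f, hf, rfl⟩
      induction x using Quotient.inductionOn with
      | h x => exact ⟨x * f, I.mul_mem_left _ _ hf, rfl⟩)
    (by
      rintro _ x ⟨f, hf, rfl⟩
      induction x using Quotient.inductionOn with
      | h x => exact ⟨f * x, I.mul_mem_right _ _ hf, rfl⟩)
  have hJ (q) : q ∈ J ↔ ∃ f ∈ I, (f : S.ringCon.Quotient) = q := TwoSidedIdeal.mem_mk' _ _ _ _ _ _ _
  rcases eq_bot_or_eq_top J with h | h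
  · left
    intro f hf
    have h1 : (f : S.ringCon.Quotient) ∈ J := (hJ _).2 ⟨f, hf, rfl⟩
    rw [h, TwoSidedIdeal.mem_bot] at h1
    exact (RingCon.eq S.ringCon).1 h1
  · right
    intro a
    have h1 : (a : S.ringCon.Quotient) ∈ J := by rw [h]; trivial
    obtain ⟨f, hf, h2⟩ := (hJ _).1 h1
    exact ⟨f, hf, (S.rel_iff _ _).1 ((RingCon.eq S.ringCon).1 h2.symm)⟩

/-- An ideal of the quotient is tested on its preimage in `R`: a preimage inside `S` makes it zero,
a preimage equal to `R` makes it everything. -/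
theorem isSimpleRing_quotient {S : TwoSidedIdeal R} (hS : ∃ a, a ∉ S)
    (h : ∀ I : TwoSidedIdeal R, I ≤ S ∨ ∀ a, a ∈ I) : IsSimpleRing S.ringCon.Quotient := by
  obtain ⟨a, ha⟩ := hS
  have : Nontrivial (TwoSidedIdeal S.ringCon.Quotient) := by
    refine ⟨⊥, ⊤, fun e => ha ?_⟩
    have h1 : (a : S.ringCon.Quotient) ∈ (⊥ : TwoSidedIdeal S.ringCon.Quotient) := by
      rw [e]; trivial
    exact (RingCon.eq S.ringCon).1 ((TwoSidedIdeal.mem_bot _).1 h1)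
  refine ⟨⟨fun J => ?_⟩⟩
  let I : TwoSidedIdeal R := TwoSidedIdeal.mk' {f | (f : S.ringCon.Quotient) ∈ J}
    J.zero_mem (fun hf hg => J.add_mem hf hg) (fun hf => J.neg_mem hf)
    (fun {f g} hf => J.mul_mem_left (f : S.ringCon.Quotient) (g : S.ringCon.Quotient) hf)
    (fun {f g} hf => J.mul_mem_right (f : S.ringCon.Quotient) (g : S.ringCon.Quotient) hf)
  have hI (f) : f ∈ I ↔ (f : S.ringCon.Quotient) ∈ J := TwoSidedIdeal.mem_mk' _ _ _ _ _ _ _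
  rcases h I with h | h
  · left
    refine le_antisymm (fun q hq => ?_) bot_le
    induction q using Quotient.inductionOn with
    | h f => exact (TwoSidedIdeal.mem_bot _).2 ((RingCon.eq S.ringCon).2 (h ((hI f).2 hq)))
  · right
    refine le_antisymm le_top (fun q _ => ?_)
    induction q using Quotient.inductionOn with
    | h f => exact (hI f).1 (h f)

end QuotientIdeals

/-! ### Units, isotropy and compact bisections -/

section Units

variable {G : Type u} [ArrowGroupoid G]

theorem ran_eq_of_mem_unitSpace {x : G} (hx : x ∈ unitSpace G) : ran x = x := by
  have h : dom x = x := hx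
  rw [← h, ArrowGroupoid.ran_dom]

theorem domMap_coe (x : unitSpace G) : domMap (x : G) = x := Subtype.ext x.2

theorem ranMap_coe (x : unitSpace G) : ranMap (x : G) = x :=
  Subtype.ext (ran_eq_of_mem_unitSpace x.2)

end Units

section Bisections

variable {G : Type u} [ArrowGroupoid G] [TopologicalSpace G]

/-- The domain map is injective near a unit `x`. For `g` close to `x` both `g` and `dom g` lie in
that neighbourhood and have the same domain, so they coincide. -/
theorem isOpen_unitSpace [IsEtale G] : IsOpen (unitSpace G) := by
  rw [isOpen_iff_mem_nhds]
  intro x hx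
  have hx' : dom x = x := hx
  obtain ⟨e, hxe, he⟩ := IsEtale.isLocalHomeomorph_dom (G := G) x
  have h1 : e.source ∈ 𝓝 x := e.open_source.mem_nhds hxe
  have h2 : dom ⁻¹' e.source ∈ 𝓝 x :=
    IsTopologicalGroupoid.continuous_dom.continuousAt.preimage_mem_nhds (by rwa [hx'])
  filter_upwards [h1, h2] with g hg hg'
  refine e.injOn hg' hg ?_
  rw [← he]
  exact Subtype.ext (dom_dom g)

theorem continuous_domMap [IsEtale G] : Continuous (domMap : G → unitSpace G) :=
  IsEtale.isLocalHomeomorph_dom.continuous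

theorem continuous_ranMap [IsEtale G] : Continuous (ranMap : G → unitSpace G) :=
  isLocalHomeomorph_ran.continuous

/-- An equaliser of two continuous maps into the Hausdorff unit space; no separation of `G` is
needed. -/
theorem isClosed_iso [IsEtale G] : IsClosed (iso G) := by
  have : T2Space (unitSpace G) := IsEtale.t2Space_unitSpace
  convert isClosed_eq (continuous_domMap (G := G)) continuous_ranMap using 1
  ext g
  exact ⟨fun h => Subtype.ext h, fun h => congrArg Subtype.val h⟩

theorem isLocalBisection_of_subset_unitSpace [IsEtale G] {V : Set G} (hV : IsOpen V)
    (h : V ⊆ unitSpace G) : IsLocalBisection V := by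
  refine isLocalBisection_of_injOn hV (fun a ha b hb e => ?_) (fun a ha b hb e => ?_)
  · have h1 : dom a = a := h ha
    have h2 : dom b = b := h hb
    rw [← h1, ← h2, e]
  · rw [← ran_eq_of_mem_unitSpace (h ha), ← ran_eq_of_mem_unitSpace (h hb), e]

/-- A compact local bisection. -/
structure IsCompactBisection (U : Set G) : Prop extends IsLocalBisection U where
  isCompact : IsCompact U

theorem IsLocalBisection.mono [IsEtale G] {U V : Set G} (hU : IsLocalBisection U) (hV : IsOpen V)
    (h : V ⊆ U) : IsLocalBisection V :=
  isLocalBisection_of_injOn hV (hU.injOn_dom.mono h) (hU.injOn_ran.mono h)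

theorem IsCompactBisection.setMul [IsEtale G] {U V : Set G} (hU : IsCompactBisection U)
    (hV : IsCompactBisection V) : IsCompactBisection (setMul U V) :=
  ⟨hU.toIsLocalBisection.setMul hV.toIsLocalBisection, isCompact_setMul hU.isCompact hV.isCompact⟩

theorem IsCompactBisection.preimage_inv [IsEtale G] {U : Set G} (hU : IsCompactBisection U) :
    IsCompactBisection (inv ⁻¹' U) :=
  ⟨hU.toIsLocalBisection.preimage_inv, (invHomeo G).isClosedEmbedding.isCompact_preimage hU.isCompact⟩

/-- Compact open sets of units are compact bisections. -/
theorem isCompactBisection_coe [IsEtale G] {V : Set (unitSpace G)} (hV : IsOpen V)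
    (hVc : IsCompact V) : IsCompactBisection (Subtype.val '' V : Set G) :=
  ⟨isLocalBisection_of_subset_unitSpace (isOpen_unitSpace.isOpenMap_subtype_val _ hV)
    (by rintro _ ⟨x, -, rfl⟩; exact x.2), hVc.image continuous_subtype_val⟩

/-- The compact bisections form a basis of the topology. -/
theorem exists_isCompactBisection [IsAmple G] {W : Set G} (hW : IsOpen W) {g : G} (hg : g ∈ W) :
    ∃ U, IsCompactBisection U ∧ g ∈ U ∧ U ⊆ W := by
  obtain ⟨e, hge, he⟩ := IsEtale.isLocalHomeomorph_dom (G := G) g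
  obtain ⟨e', hge', he'⟩ := isLocalHomeomorph_ran (G := G) g
  set A := W ∩ (e.source ∩ e'.source) with hA
  have hAo : IsOpen A := hW.inter (e.open_source.inter e'.open_source)
  have hAb : IsLocalBisection A := by
    refine isLocalBisection_of_injOn hAo (fun a ha b hb h => ?_) (fun a ha b hb h => ?_)
    · exact e.injOn ha.2.1 hb.2.1 (by rw [← he]; exact Subtype.ext h)
    · exact e'.injOn ha.2.2 hb.2.2 (by rw [← he']; exact Subtype.ext h)
  obtain ⟨V, ⟨hVo, hVc⟩, hgV, hVA⟩ :=
    IsAmple.isTopologicalBasis_compactOpen.exists_subset_of_mem_open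
      (show domMap g ∈ domMap '' A from ⟨g, ⟨hg, hge, hge'⟩, rfl⟩)
      (IsEtale.isLocalHomeomorph_dom.isOpenMap _ hAo)
  have hUo : IsOpen (A ∩ domMap ⁻¹' V) := hAo.inter (hVo.preimage continuous_domMap)
  refine ⟨A ∩ domMap ⁻¹' V, ⟨hAb.mono hUo Set.inter_subset_left, ?_⟩,
    ⟨⟨hg, hge, hge'⟩, hgV⟩, fun x hx => hx.1.1⟩
  -- Compactness of `V` lifts because `V` lies in the image of `A`, on which the domain map is an
  -- embedding.
  have hc : IsCompact ((fun a : A => domMap a.1) ⁻¹' V) := by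
    refine hAb.isEmbedding_dom.toIsInducing.isCompact_preimage_iff ?_ |>.2 hVc
    intro y hy
    obtain ⟨a, ha, rfl⟩ := hVA hy
    exact ⟨⟨a, ha⟩, rfl⟩
  convert hc.image continuous_subtype_val using 1
  ext x
  simp [and_comm]

/-- A compact bisection meets a closed set with empty interior in arrows whose ranges form a
nowhere dense closed set. -/
theorem IsCompactBisection.isOpen_dense_compl_image_ranMap [IsEtale G] {U C : Set G}
    (hU : IsCompactBisection U) (hC : IsClosed C) (hC' : interior C = ∅) :
    IsOpen (ranMap '' (U ∩ C) : Set (unitSpace G))ᶜ ∧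
      Dense (ranMap '' (U ∩ C) : Set (unitSpace G))ᶜ := by
  have : T2Space (unitSpace G) := IsEtale.t2Space_unitSpace
  refine ⟨((hU.isCompact.inter_right hC).image continuous_ranMap).isClosed.isOpen_compl, ?_⟩
  rw [← interior_eq_empty_iff_dense_compl, Set.eq_empty_iff_forall_notMem]
  intro x hx
  obtain ⟨g, hg, rfl⟩ := interior_subset hx
  -- Since the range map is injective on `U`, an open set inside the image would pull back to an
  -- open subset of `C`.
  have hsub : U ∩ ranMap ⁻¹' interior (ranMap '' (U ∩ C)) ⊆ C := by
    rintro a ⟨ha, ha'⟩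
    obtain ⟨b, hb, hab⟩ := interior_subset ha'
    rw [hU.injOn_ran ha hb.1 (congrArg Subtype.val hab.symm)]
    exact hb.2
  have := interior_maximal hsub (hU.isOpen.inter (isOpen_interior.preimage continuous_ranMap))
    ⟨hg.1, hx⟩
  rw [hC'] at this
  exact this

end Bisections

/-! ### Convolution by sets of units, and the action on arbitrary functions -/

section Convolution

variable {K : Type v} [CommRing K] {G : Type u} [ArrowGroupoid G]

/-- The only factorization of `g` with a unit on the left is `r(g) g`, so a set of units acts by
cutting down to arrows with range in it. -/
theorem conv_char_coe_left (V : Set (unitSpace G)) (f : G → K) (g : G) :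
    conv (char K (Subtype.val '' V : Set G)) f g = char K V (ranMap g) * f g := by
  have hinj : Set.InjOn ran (Subtype.val '' V : Set G) := by
    rintro _ ⟨a, -, rfl⟩ _ ⟨b, -, rfl⟩ h
    rwa [ran_eq_of_mem_unitSpace a.2, ran_eq_of_mem_unitSpace b.2] at h
  by_cases hg : ranMap g ∈ V
  · rw [conv_char_left hinj f ⟨ranMap g, hg, rfl⟩ (isProd_ran g)]
    simp [char, hg]
  · have : conv (char K (Subtype.val '' V : Set G)) f g = 0 := by
      by_contra hne
      obtain ⟨_, ⟨a, ha, rfl⟩, b, hb⟩ := exists_of_conv_char_left_ne hne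
      refine hg ?_
      have : ranMap g = a := Subtype.ext (hb.ran_eq.trans (ran_eq_of_mem_unitSpace a.2))
      rwa [this]
    rw [this]
    simp [char, hg]

theorem conv_char_coe_right (V : Set (unitSpace G)) (f : G → K) (g : G) :
    conv f (char K (Subtype.val '' V : Set G)) g = char K V (domMap g) * f g := by
  have hinj : Set.InjOn dom (Subtype.val '' V : Set G) := by
    rintro _ ⟨a, -, rfl⟩ _ ⟨b, -, rfl⟩ h
    have h1 : dom (a : G) = a := a.2
    have h2 : dom (b : G) = b := b.2
    rwa [h1, h2] at h
  by_cases hg : domMap g ∈ V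
  · rw [conv_char_right hinj f ⟨domMap g, hg, rfl⟩ (isProd_dom g)]
    simp [char, hg]
  · have : conv f (char K (Subtype.val '' V : Set G)) g = 0 := by
      by_contra hne
      obtain ⟨_, ⟨a, ha, rfl⟩, b, hb⟩ := exists_of_conv_char_right_ne hne
      refine hg ?_
      have : domMap g = a := Subtype.ext (hb.dom_eq.trans a.2)
      rwa [this]
    rw [this]
    simp [char, hg]

variable [TopologicalSpace G]

theorem IsCompactBisection.char_mem {U : Set G} (hU : IsCompactBisection U) :
    char K U ∈ steinbergSubmodule K G :=
  Submodule.subset_span ⟨U, hU.toIsLocalBisection, hU.isCompact, rfl⟩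

/-- The support of an element of the Steinberg algebra is covered by finitely many compact
bisections. -/
theorem exists_finite_cover_of_mem {f : G → K} (hf : f ∈ steinbergSubmodule K G) :
    ∃ s : Set (Set G), s.Finite ∧ (∀ U ∈ s, IsCompactBisection U) ∧
      Function.support f ⊆ ⋃₀ s := by
  induction hf using Submodule.span_induction with
  | mem f h =>
    obtain ⟨U, hU, hUc, rfl⟩ := h
    exact ⟨{U}, Set.finite_singleton U, by rintro _ rfl; exact ⟨hU, hUc⟩,
      by rw [Set.sUnion_singleton]; exact Set.support_indicator_subset⟩
  | zero => exact ⟨∅, Set.finite_empty, by simp, by simp⟩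
  | add f g _ _ hf hg =>
    obtain ⟨s, hs, hsb, hfs⟩ := hf
    obtain ⟨t, ht, htb, hgt⟩ := hg
    refine ⟨s ∪ t, hs.union ht, fun U hU => hU.elim (hsb U) (htb U), ?_⟩
    rw [Set.sUnion_union]
    exact (Function.support_add f g).trans (Set.union_subset_union hfs hgt)
  | smul r f _ hf =>
    obtain ⟨s, hs, hsb, hfs⟩ := hf
    exact ⟨s, hs, hsb, (Function.support_const_smul_subset r f).trans hfs⟩

/-- Steinberg functions act associatively on all functions. -/
theorem conv_conv [IsAmple G] {f g : G → K} (hf : f ∈ steinbergSubmodule K G)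
    (hg : g ∈ steinbergSubmodule K G) (ψ : G → K) : conv (conv f g) ψ = conv f (conv g ψ) := by
  have ff : ∀ {f : G → K}, f ∈ steinbergSubmodule K G → FiberFinite f := fiberFinite_of_mem
  induction hf using Submodule.span_induction with
  | zero => simp
  | add f₁ f₂ m₁ m₂ h₁ h₂ =>
    rw [conv_add_left (ff m₁) (ff m₂), conv_add_left (ff m₁) (ff m₂),
      conv_add_left (ff (conv_mem m₁ hg)) (ff (conv_mem m₂ hg)), h₁, h₂]
  | smul r f m h =>
    rw [conv_smul_left (ff m), conv_smul_left (ff m), conv_smul_left (ff (conv_mem m hg)), h]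
  | mem f h =>
    have hf : f ∈ steinbergSubmodule K G := Submodule.subset_span h
    obtain ⟨U, hU, -, rfl⟩ := h
    induction hg using Submodule.span_induction with
    | zero => simp
    | add g₁ g₂ m₁ m₂ h₁ h₂ =>
      rw [conv_add_right (ff hf), conv_add_left (ff m₁) (ff m₂),
        conv_add_left (ff (conv_mem hf m₁)) (ff (conv_mem hf m₂)), conv_add_right (ff hf), h₁, h₂]
    | smul r g m h =>
      rw [conv_smul_right (ff hf), conv_smul_left (ff m), conv_smul_left (ff (conv_mem hf m)),
        conv_smul_right (ff hf), h]
    | mem g h =>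
      obtain ⟨V, hV, -, rfl⟩ := h
      rw [conv_char_char hU.injOn_ran]
      funext y
      -- A non-zero value on either side supplies a factorization of `y` into three arrows, and
      -- reassociating it evaluates the other side.
      by_cases h1 : conv (char K U) (conv (char K V) ψ) y = 0
      · rw [h1]
        by_contra h2
        obtain ⟨x, ⟨a, ha, b, hb, h⟩, c, hc⟩ := exists_of_conv_char_left_ne h2
        rw [conv_char_left (hU.setMul hV).injOn_ran ψ ⟨a, ha, b, hb, h⟩ hc] at h2
        obtain ⟨z, hz, hz'⟩ := h.assoc hc
        rw [conv_char_left hU.injOn_ran _ ha hz', conv_char_left hV.injOn_ran _ hb hz] at h1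
        exact h2 h1
      · obtain ⟨a, ha, z, hz'⟩ := exists_of_conv_char_left_ne h1
        rw [conv_char_left hU.injOn_ran _ ha hz'] at h1
        obtain ⟨b, hb, c, hz⟩ := exists_of_conv_char_left_ne h1
        obtain ⟨x, hx, hx'⟩ := IsProd.assoc_symm hz hz'
        rw [conv_char_left hU.injOn_ran _ ha hz', conv_char_left hV.injOn_ran _ hb hz,
          conv_char_left (hU.setMul hV).injOn_ran ψ ⟨a, ha, b, hb, hx⟩ hx']

end Convolution

/-! ### Singular functions seen from the unit space -/

section Singular

variable {K : Type v} [CommRing K] {G : Type u} [ArrowGroupoid G] [TopologicalSpace G]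

/-- A singular element of the Steinberg algebra vanishes on the range fibres of a dense set of
units. -/
theorem IsSingular.exists_dense_ranMap [IsEtale G] {f : G → K} (hf : f ∈ steinbergSubmodule K G)
    (hs : IsSingular f) :
    ∃ D : Set (unitSpace G), Dense D ∧ ∀ g, ranMap g ∈ D → f g = 0 := by
  have : T2Space (unitSpace G) := IsEtale.t2Space_unitSpace
  have : LocallyCompactSpace (unitSpace G) := IsEtale.locallyCompactSpace_unitSpace
  obtain ⟨E, hE, hEd, hfE⟩ := hs.exists_dense hf
  obtain ⟨s, hs, hsb, hfs⟩ := exists_finite_cover_of_mem hf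
  have hC : interior Eᶜ = ∅ := by rwa [interior_eq_empty_iff_dense_compl, compl_compl]
  -- Off the dense open set `E` the support is covered by finitely many bisections, each
  -- contributing a nowhere dense closed set of ranges. Avoiding all of these ranges kills the
  -- entire fibre.
  refine ⟨⋂ U ∈ s, (ranMap '' (U ∩ Eᶜ))ᶜ, dense_biInter_of_isOpen
    (fun U hU => ((hsb U hU).isOpen_dense_compl_image_ranMap hE.isClosed_compl hC).1)
    hs.countable
    (fun U hU => ((hsb U hU).isOpen_dense_compl_image_ranMap hE.isClosed_compl hC).2), ?_⟩
  intro g hg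
  by_contra hne
  obtain ⟨U, hU, hgU⟩ := hfs hne
  exact Set.mem_iInter₂.1 hg U hU ⟨g, ⟨hgU, fun h => hne (hfE g h)⟩, rfl⟩

/-- The unit space is open in `G`, so this support contains a non-empty open set. -/
theorem not_isSingular_char_coe [IsEtale G] [Nontrivial K] {V : Set (unitSpace G)}
    (hV : IsOpen V) (hne : V.Nonempty) : ¬ IsSingular (char K (Subtype.val '' V : Set G)) := by
  intro h
  obtain ⟨x, hx⟩ := hne
  have hsub : (Subtype.val '' V : Set G) ⊆ Function.support (char K (Subtype.val '' V : Set G)) :=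
    fun g hg => by simp only [char, Function.mem_support, Set.indicator_of_mem hg]; exact one_ne_zero
  have := interior_maximal hsub (isOpen_unitSpace.isOpenMap_subtype_val _ hV) ⟨x, hx, rfl⟩
  rw [h] at this
  exact this

end Singular

/-! ### The action on functions of units; simplicity forces topological freeness -/

section ActionKernel

variable {K : Type v} [CommRing K] {G : Type u} [ArrowGroupoid G]

/-- Functions on the unit space are encoded as functions constant on range fibres. The factorization
`c = a (a⁻¹ c)` has `r(a⁻¹ c) = d(a)`, so a bisection moves values along its arrows. -/
theorem conv_char_comp_ranMap {U : Set G} (hU : Set.InjOn ran U) (φ : unitSpace G → K) {a c : G}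
    (ha : a ∈ U) (h : ran a = ran c) : conv (char K U) (φ ∘ ranMap) c = φ (domMap a) := by
  obtain ⟨b, hb⟩ := isProd_of (a := inv a) (b := c) (by rw [ArrowGroupoid.dom_inv, h])
  have hb' := hb.left_inv
  rw [inv_inv] at hb'
  rw [conv_char_left hU _ ha hb']
  exact congrArg φ (Subtype.ext hb'.1.symm)

theorem conv_char_comp_ranMap_eq_zero {U : Set G} (φ : unitSpace G → K) {c : G}
    (h : ∀ a ∈ U, ran a ≠ ran c) : conv (char K U) (φ ∘ ranMap) c = 0 := by
  by_contra hne
  obtain ⟨a, ha, b, hb⟩ := exists_of_conv_char_left_ne hne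
  exact h a ha hb.ran_eq.symm

variable [TopologicalSpace G]

/-- The Steinberg algebra acts on functions on the unit space. -/
theorem exists_conv_comp_ranMap_eq {f : G → K} (hf : f ∈ steinbergSubmodule K G)
    (φ : unitSpace G → K) : ∃ φ' : unitSpace G → K, conv f (φ ∘ ranMap) = φ' ∘ ranMap := by
  -- The candidate for `φ'` is the restriction of the convolution to units.
  suffices h : ∀ c, conv f (φ ∘ ranMap) c = conv f (φ ∘ ranMap) (ran c) from
    ⟨fun x => conv f (φ ∘ ranMap) x, funext h⟩
  intro c
  induction hf using Submodule.span_induction with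
  | mem f h =>
    obtain ⟨U, hU, -, rfl⟩ := h
    by_cases hc : ∃ a ∈ U, ran a = ran c
    · obtain ⟨a, ha, hac⟩ := hc
      rw [conv_char_comp_ranMap hU.injOn_ran φ ha hac,
        conv_char_comp_ranMap hU.injOn_ran φ ha (by rw [ran_ran, hac])]
    · push Not at hc
      rw [conv_char_comp_ranMap_eq_zero φ hc,
        conv_char_comp_ranMap_eq_zero φ (by simpa only [ran_ran] using hc)]
  | zero => simp
  | add f g mf mg hf hg =>
    rw [conv_add_left (fiberFinite_of_mem mf) (fiberFinite_of_mem mg), Pi.add_apply, Pi.add_apply,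
      hf, hg]
  | smul r f m h =>
    rw [conv_smul_left (fiberFinite_of_mem m), Pi.smul_apply, Pi.smul_apply, h]

variable [IsAmple G]

variable (K G) in
/-- The kernel of the action of the Steinberg algebra on functions on the unit space. -/
noncomputable def actionKernel : TwoSidedIdeal (SteinbergAlgebra K G) :=
  TwoSidedIdeal.mk' {f | ∀ φ : unitSpace G → K, conv f.1 (φ ∘ ranMap) = 0}
    (fun _ => conv_zero_left _)
    (fun {f g} hf hg φ => by
      have h : conv (f.1 + g.1) (φ ∘ ranMap) = 0 := by
        rw [conv_add_left (fiberFinite_of_mem f.2) (fiberFinite_of_mem g.2), hf φ, hg φ, add_zero]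
      exact h)
    (fun {f} hf φ => by
      have h : conv (-f.1) (φ ∘ ranMap) = 0 := by
        rw [← neg_one_smul K f.1, conv_smul_left (fiberFinite_of_mem f.2), hf φ, smul_zero]
      exact h)
    (fun {f g} hg φ => by
      have h : conv (conv f.1 g.1) (φ ∘ ranMap) = 0 := by
        rw [conv_conv f.2 g.2, hg φ, conv_zero_right]
      exact h)
    (fun {f g} hf φ => by
      have h : conv (conv f.1 g.1) (φ ∘ ranMap) = 0 := by
        -- Acting by `g` gives another function of the range, which `f` annihilates.
        obtain ⟨φ', h'⟩ := exists_conv_comp_ranMap_eq g.2 φ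
        rw [conv_conv f.2 g.2, h', hf φ']
      exact h)

theorem mem_actionKernel {f : SteinbergAlgebra K G} :
    f ∈ actionKernel K G ↔ ∀ φ : unitSpace G → K, conv f.1 (φ ∘ ranMap) = 0 :=
  TwoSidedIdeal.mem_mk' _ _ _ _ _ _ f

/-- A bisection inside the isotropy acts on functions of units exactly as the set of its domains
does, so the difference is in `actionKernel`. Non-unit isotropy makes that difference non-singular.
-/
theorem isTopologicallyFree_of_isSimpleRing [Nontrivial K]
    [IsSimpleRing (EssentialAlgebra K G)] : IsTopologicallyFree G := by
  rw [IsTopologicallyFree]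
  by_contra hne
  obtain ⟨g, hg⟩ := Set.nonempty_iff_ne_empty.2 hne
  obtain ⟨U, hU, hgU, hUsub⟩ := exists_isCompactBisection isOpen_interior hg
  replace hUsub := hUsub.trans interior_subset
  set V : Set (unitSpace G) := domMap '' U
  have hV : IsOpen V := IsEtale.isLocalHomeomorph_dom.isOpenMap _ hU.isOpen
  have hVc : IsCompact V := hU.isCompact.image continuous_domMap
  have hVb := isCompactBisection_coe hV hVc
  let a : SteinbergAlgebra K G := ⟨char K (Subtype.val '' V), hVb.char_mem⟩
  let f : SteinbergAlgebra K G := ⟨char K U - char K (Subtype.val '' V),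
    Submodule.sub_mem _ hU.char_mem hVb.char_mem⟩
  have hf : f ∈ actionKernel K G := by
    rw [mem_actionKernel]
    intro φ
    have hsplit : conv (char K U) (φ ∘ ranMap) =
        conv f.1 (φ ∘ ranMap) + conv (char K (Subtype.val '' V)) (φ ∘ ranMap) := by
      rw [← conv_add_left (fiberFinite_of_mem f.2) (fiberFinite_of_mem hVb.char_mem)]
      exact congrArg (conv · _) (sub_add_cancel _ _).symm
    -- Vanishing of the action of `f` is recast as equality of the actions of `U` and of `V`.
    rw [← add_eq_right, ← hsplit]
    funext c
    by_cases hc : ∃ b ∈ U, ran b = ran c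
    · obtain ⟨b, hb, hbc⟩ := hc
      have hdr : dom b = ran b := (hUsub hb).1
      rw [conv_char_comp_ranMap hU.injOn_ran φ hb hbc,
        conv_char_comp_ranMap hVb.injOn_ran φ (a := dom b) ⟨domMap b, ⟨b, hb, rfl⟩, rfl⟩
          (by rw [ran_dom, hdr, hbc])]
      exact congrArg φ (Subtype.ext (dom_dom b).symm)
    · push Not at hc
      rw [conv_char_comp_ranMap_eq_zero φ hc, conv_char_comp_ranMap_eq_zero φ]
      rintro _ ⟨_, ⟨b, hb, rfl⟩, rfl⟩ h
      have hdr : dom b = ran b := (hUsub hb).1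
      exact hc b hb (by rw [← hdr, ← h]; exact (ran_dom b).symm)
  rcases le_or_forall_exists_sub_mem_of_isSimpleRing (S := singularIdeal K G)
    (actionKernel K G) with h | h
  · have hs : IsSingular f.1 := mem_singularIdeal.1 (h hf)
    have hsub : U ⊆ Function.support f.1 := by
      intro b hb
      have hb' : b ∉ (Subtype.val '' V : Set G) := by
        rintro ⟨x, -, rfl⟩
        exact (hUsub hb).2 x.2
      change char K U b - char K (Subtype.val '' V) b ≠ 0
      simp only [char, Set.indicator_of_mem hb, Set.indicator_of_notMem hb', sub_zero]
      exact one_ne_zero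
    have := interior_maximal hsub hU.isOpen hgU
    rw [hs] at this
    exact this
  · obtain ⟨k, hk, hs⟩ := h a
    obtain ⟨D, hD, hDz⟩ := IsSingular.exists_dense_ranMap (a - k).2 (mem_singularIdeal.1 hs)
    obtain ⟨x, hxV, hxD⟩ := hD.inter_open_nonempty V hV ⟨_, g, hgU, rfl⟩
    -- Testing on the constant function at `x`: `a` gives 1, while the singular function `a - k`,
    -- acting the same way, gives 0.
    let φ : unitSpace G → K := fun _ => 1
    have hsplit : conv a.1 (φ ∘ ranMap) = conv (a - k).1 (φ ∘ ranMap) + conv k.1 (φ ∘ ranMap) := by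
      rw [← conv_add_left (fiberFinite_of_mem (a - k).2) (fiberFinite_of_mem k.2)]
      exact congrArg (conv · _) (sub_add_cancel a.1 k.1).symm
    rw [mem_actionKernel.1 hk φ, add_zero] at hsplit
    have h1 : conv a.1 (φ ∘ ranMap) x = 1 := by
      rw [conv_char_coe_left, ranMap_coe]
      simp [char, hxV, φ]
    have h2 : conv (a - k).1 (φ ∘ ranMap) x = 0 := by
      refine finsum_eq_zero_of_forall_eq_zero fun p => ?_
      rw [hDz p.1.1, zero_mul]
      have : ranMap p.1.1 = x :=
        Subtype.ext (p.2.ran_eq.symm.trans (ran_eq_of_mem_unitSpace x.2))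
      rwa [this]
    rw [hsplit, h2] at h1
    exact zero_ne_one h1

end ActionKernel

/-! ### Simplicity forces minimality -/

section Minimal

variable {K : Type v} [CommRing K] {G : Type u} [ArrowGroupoid G]

theorem exists_factor_of_conv_ne_zero {f g : G → K} {c : G} (h : conv f g c ≠ 0) :
    ∃ p : Factor c, f p.1.1 * g p.1.2 ≠ 0 := by
  by_contra! hn
  exact h (finsum_eq_zero_of_forall_eq_zero hn)

variable [TopologicalSpace G] [IsAmple G]

variable (K) in
/-- The ideal of the functions whose support lies over a compact subset of an invariant set. -/
noncomputable def invariantIdeal {X : Set (unitSpace G)} (hX : IsInvariant X) :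
    TwoSidedIdeal (SteinbergAlgebra K G) :=
  TwoSidedIdeal.mk'
    {f | ∃ C : Set (unitSpace G), IsCompact C ∧ C ⊆ X ∧ ∀ g, f.1 g ≠ 0 → domMap g ∈ C}
    ⟨∅, isCompact_empty, Set.empty_subset _, fun _ h => (h rfl).elim⟩
    (by
      rintro f g ⟨C, hC, hCX, hf⟩ ⟨C', hC', hCX', hg⟩
      refine ⟨C ∪ C', hC.union hC', Set.union_subset hCX hCX', fun c hc => ?_⟩
      by_contra hn
      rw [Set.mem_union, not_or] at hn
      refine hc ?_
      change f.1 c + g.1 c = 0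
      rw [not_not.1 (mt (hf c) hn.1), not_not.1 (mt (hg c) hn.2), add_zero])
    (by
      rintro f ⟨C, hC, hCX, hf⟩
      refine ⟨C, hC, hCX, fun c hc => hf c fun h => hc ?_⟩
      change -f.1 c = 0
      rw [h, neg_zero])
    (by
      rintro f g ⟨C, hC, hCX, hg⟩
      refine ⟨C, hC, hCX, fun c hc => ?_⟩
      obtain ⟨p, hp⟩ := exists_factor_of_conv_ne_zero hc
      have h := hg _ (right_ne_zero_of_mul hp)
      have e : domMap p.1.2 = domMap c := Subtype.ext p.2.dom_eq.symm
      rwa [e] at h)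
    (by
      have : T2Space (unitSpace G) := IsEtale.t2Space_unitSpace
      rintro f g ⟨C, hC, hCX, hf⟩
      obtain ⟨s, hs, hsb, hgs⟩ := exists_finite_cover_of_mem g.2
      -- Right multiplication transports `C` backwards along the arrows of the bisections covering
      -- `g`. There are finitely many and `C` is closed, so the result is compact; invariance keeps
      -- it in `X`.
      refine ⟨⋃ U ∈ s, domMap '' (U ∩ ranMap ⁻¹' C), hs.isCompact_biUnion fun U hU =>
        ((hsb U hU).isCompact.inter_right (hC.isClosed.preimage continuous_ranMap)).image
          continuous_domMap, ?_, fun c hc => ?_⟩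
      · refine Set.iUnion₂_subset fun U _ => ?_
        rintro _ ⟨b, ⟨-, hb⟩, rfl⟩
        exact hX _ (hCX hb) ⟨inv b, Subtype.ext (ArrowGroupoid.dom_inv b),
          Subtype.ext (ArrowGroupoid.ran_inv b)⟩
      · obtain ⟨p, hp⟩ := exists_factor_of_conv_ne_zero hc
        obtain ⟨U, hU, hbU⟩ := hgs (right_ne_zero_of_mul hp)
        have h := hf _ (left_ne_zero_of_mul hp)
        have e : domMap p.1.1 = ranMap p.1.2 := Subtype.ext p.2.1
        rw [e] at h
        exact Set.mem_iUnion₂.2 ⟨U, hU, p.1.2, ⟨hbU, h⟩, Subtype.ext p.2.dom_eq.symm⟩)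

theorem mem_invariantIdeal {X : Set (unitSpace G)} {hX : IsInvariant X}
    {f : SteinbergAlgebra K G} : f ∈ invariantIdeal K hX ↔
      ∃ C : Set (unitSpace G), IsCompact C ∧ C ⊆ X ∧ ∀ g, f.1 g ≠ 0 → domMap g ∈ C :=
  TwoSidedIdeal.mem_mk' _ _ _ _ _ _ f

theorem exists_compactOpen_subset {X : Set (unitSpace G)} (hX : IsOpen X) {x : unitSpace G}
    (hx : x ∈ X) : ∃ V : Set (unitSpace G), IsOpen V ∧ IsCompact V ∧ x ∈ V ∧ V ⊆ X := by
  obtain ⟨V, ⟨hV, hVc⟩, h, h'⟩ :=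
    IsAmple.isTopologicalBasis_compactOpen.exists_subset_of_mem_open hx hX
  exact ⟨V, hV, hVc, h, h'⟩

/-- The ideal of functions living over compact subsets of `X` is not singular when `X` is open and
non-empty, and is too small modulo singular functions when some unit `y` is missed. -/
theorem isMinimal_of_isSimpleRing [Nontrivial K] [IsSimpleRing (EssentialAlgebra K G)] :
    IsMinimal G := by
  have : T2Space (unitSpace G) := IsEtale.t2Space_unitSpace
  intro X hXo hX
  by_contra! hne
  obtain ⟨⟨x, hx⟩, hne⟩ := hne
  obtain ⟨y, hy⟩ := (Set.ne_univ_iff_exists_notMem X).1 hne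
  rcases le_or_forall_exists_sub_mem_of_isSimpleRing (S := singularIdeal K G)
    (invariantIdeal K hX) with h | h
  · obtain ⟨V, hV, hVc, hxV, hVX⟩ := exists_compactOpen_subset hXo hx
    refine not_isSingular_char_coe (K := K) hV ⟨x, hxV⟩ (mem_singularIdeal.1
      (h (x := ⟨_, (isCompactBisection_coe hV hVc).char_mem⟩)
        (mem_invariantIdeal.2 ⟨V, hVc, hVX, fun g hg => ?_⟩)))
    have hg' : char K (Subtype.val '' V : Set G) g ≠ 0 := hg
    obtain ⟨z, hz, rfl⟩ := Set.mem_of_indicator_ne_zero hg'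
    rwa [domMap_coe]
  · obtain ⟨W, hW, hWc, hyW, -⟩ := exists_compactOpen_subset isOpen_univ (Set.mem_univ y)
    obtain ⟨f, hf, hs⟩ := h ⟨_, (isCompactBisection_coe hW hWc).char_mem⟩
    obtain ⟨C, hC, hCX, hfC⟩ := mem_invariantIdeal.1 hf
    have hs' : IsSingular (char K (Subtype.val '' W : Set G) - f.1) := mem_singularIdeal.1 hs
    -- Here compactness of the supports matters: `y` may lie in the closure of `X`, but `C` is
    -- closed, so `W \ C` is still an open neighbourhood of `y`.
    have hsub : (Subtype.val '' (W \ C) : Set G) ⊆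
        Function.support (char K (Subtype.val '' W : Set G) - f.1) := by
      rintro _ ⟨z, hz, rfl⟩
      have hfz : f.1 z = 0 := by
        by_contra hne
        have := hfC _ hne
        rw [domMap_coe] at this
        exact hz.2 this
      have hzW : (z : G) ∈ (Subtype.val '' W : Set G) := ⟨z, hz.1, rfl⟩
      rw [Function.mem_support, Pi.sub_apply, hfz, sub_zero, char, Set.indicator_of_mem hzW]
      exact one_ne_zero
    have := interior_maximal hsub (isOpen_unitSpace.isOpenMap_subtype_val _ (hW.sdiff hC.isClosed))
      ⟨y, ⟨hyW, fun h => hy (hCX h)⟩, rfl⟩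
    rw [hs'] at this
    exact this

end Minimal

/-! ### Topological freeness: compression near generic units -/

section LocallyUnit

variable {K : Type v} [CommRing K] {G : Type u} [ArrowGroupoid G] [TopologicalSpace G]

/-- Near a generic unit of a topologically free groupoid, a Steinberg function is a multiple of
the characteristic function of the unit space. -/
theorem exists_dense_locally_unit [IsEtale G] (hG : IsTopologicallyFree G) {f : G → K}
    (hf : f ∈ steinbergSubmodule K G) :
    ∃ D : Set (unitSpace G), IsOpen D ∧ Dense D ∧ ∀ x ∈ D, ∃ V ∈ 𝓝 x,
      ∀ g, domMap g ∈ V → ranMap g ∈ V → f g = (unitSpace G).indicator (fun _ => f x) g := by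
  have : T2Space (unitSpace G) := IsEtale.t2Space_unitSpace
  induction hf using Submodule.span_induction with
  | mem f h =>
    obtain ⟨U, hU, hUc, rfl⟩ := h
    have hUb : IsCompactBisection U := ⟨hU, hUc⟩
    have hC : IsClosed (iso G \ unitSpace G) := isClosed_iso.sdiff isOpen_unitSpace
    obtain ⟨hD, hD'⟩ := hUb.isOpen_dense_compl_image_ranMap hC hG
    -- Generic means: not the range of any non-unit isotropy arrow of `U`.
    refine ⟨_, hD, hD', fun x hx => ?_⟩
    by_cases hxU : (x : G) ∈ U
    -- If `dom g` lies in `U`, injectivity of the domain map on `U` leaves `dom g` as the only arrow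
    -- of `U` with that domain, so `g` is in `U` only if it is a unit.
    · refine ⟨Subtype.val ⁻¹' U, (hU.isOpen.preimage continuous_subtype_val).mem_nhds hxU,
        fun g hg _ => ?_⟩
      have hdU : dom g ∈ U := hg
      by_cases hg' : g ∈ unitSpace G
      · have hd : dom g = g := hg'
        rw [hd] at hdU
        simp [char, hg', hxU, hdU]
      · have hgU : g ∉ U := fun h => hg' (hU.injOn_dom hdU h (dom_dom g))
        simp [char, hg', hgU]
    · have hx0 (g : G) : (unitSpace G).indicator (fun _ => char K U x) g = 0 := by
        simp [char, hxU]
      simp only [hx0]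
      by_cases hxr : ∃ g ∈ U, ranMap g = x
      · obtain ⟨g, hgU, rfl⟩ := hxr
        have hne : domMap g ≠ ranMap g := by
          intro h
          refine hx ⟨g, ⟨hgU, congrArg Subtype.val h, fun hg => hxU ?_⟩, rfl⟩
          have hr : (ranMap g : G) = g := ran_eq_of_mem_unitSpace hg
          rwa [hr]
        obtain ⟨A, B, hA, hB, hgA, hgB, hAB⟩ := t2_separation hne
        -- An arrow of `U` with range in this set has domain in `A`, by injectivity of the range
        -- map, hence outside `B`. So `U` has no arrow with both ends in the neighbourhood.
        refine ⟨ranMap '' (U ∩ domMap ⁻¹' A) ∩ B,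
          Filter.inter_mem ((isLocalHomeomorph_ran.isOpenMap _
            (hU.isOpen.inter (hA.preimage continuous_domMap))).mem_nhds ⟨g, ⟨hgU, hgA⟩, rfl⟩)
            (hB.mem_nhds hgB), fun h hd hr => ?_⟩
        have hh : h ∉ U := by
          intro hh
          obtain ⟨h', ⟨hU', hA'⟩, e⟩ := hr.1
          rw [hU.injOn_ran hU' hh (congrArg Subtype.val e)] at hA'
          exact Set.disjoint_left.1 hAB hA' hd.2
        simp [char, hh]
      · refine ⟨(ranMap '' U)ᶜ, (hUc.image continuous_ranMap).isClosed.isOpen_compl.mem_nhds hxr,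
          fun g _ hg => ?_⟩
        have hh : g ∉ U := fun h => hg ⟨g, h, rfl⟩
        simp [char, hh]
  | zero => exact ⟨Set.univ, isOpen_univ, dense_univ, fun x _ => ⟨Set.univ, Filter.univ_mem, by simp⟩⟩
  | add f g _ _ hf hg =>
    obtain ⟨D, hD, hDd, hf⟩ := hf
    obtain ⟨E, hE, hEd, hg⟩ := hg
    refine ⟨D ∩ E, hD.inter hE, hDd.inter_of_isOpen_left hEd hD, fun x hx => ?_⟩
    obtain ⟨V, hV, hfV⟩ := hf x hx.1
    obtain ⟨W, hW, hgW⟩ := hg x hx.2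
    refine ⟨V ∩ W, Filter.inter_mem hV hW, fun a hd hr => ?_⟩
    rw [Pi.add_apply, hfV a hd.1 hr.1, hgW a hd.2 hr.2]
    by_cases ha : a ∈ unitSpace G <;> simp [ha]
  | smul r f _ hf =>
    obtain ⟨D, hD, hDd, hf⟩ := hf
    refine ⟨D, hD, hDd, fun x hx => ?_⟩
    obtain ⟨V, hV, hfV⟩ := hf x hx
    refine ⟨V, hV, fun a hd hr => ?_⟩
    rw [Pi.smul_apply, hfV a hd hr]
    by_cases ha : a ∈ unitSpace G <;> simp [ha]

end LocallyUnit

/-! ### Characteristic functions of units inside an ideal -/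

section Simple

variable {K : Type v} [CommRing K] {G : Type u} [ArrowGroupoid G] [TopologicalSpace G] [IsAmple G]

/-- Membership of a function in an ideal of the Steinberg algebra. -/
def InIdeal (I : TwoSidedIdeal (SteinbergAlgebra K G)) (f : G → K) : Prop :=
  ∃ h : f ∈ steinbergSubmodule K G, (⟨f, h⟩ : SteinbergAlgebra K G) ∈ I

variable {I : TwoSidedIdeal (SteinbergAlgebra K G)}

theorem InIdeal.conv_left {f g : G → K} (hf : f ∈ steinbergSubmodule K G) (hg : InIdeal I g) :
    InIdeal I (conv f g) :=
  ⟨conv_mem hf hg.1, I.mul_mem_left (⟨f, hf⟩ : SteinbergAlgebra K G) ⟨g, hg.1⟩ hg.2⟩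

theorem InIdeal.conv_right {f g : G → K} (hf : InIdeal I f) (hg : g ∈ steinbergSubmodule K G) :
    InIdeal I (conv f g) :=
  ⟨conv_mem hf.1 hg, I.mul_mem_right (⟨f, hf.1⟩ : SteinbergAlgebra K G) ⟨g, hg⟩ hf.2⟩

theorem InIdeal.add {f g : G → K} (hf : InIdeal I f) (hg : InIdeal I g) : InIdeal I (f + g) :=
  ⟨add_mem hf.1 hg.1, I.add_mem hf.2 hg.2⟩

theorem InIdeal.sub {f g : G → K} (hf : InIdeal I f) (hg : InIdeal I g) : InIdeal I (f - g) :=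
  ⟨sub_mem hf.1 hg.1, I.sub_mem hf.2 hg.2⟩

variable (I) in
/-- The compact open sets of units whose characteristic function lies in an ideal. -/
def unitSets : Set (Set (unitSpace G)) :=
  {V | IsOpen V ∧ IsCompact V ∧ InIdeal I (char K (Subtype.val '' V : Set G))}

/-- Inclusion-exclusion: `1_V + 1_W - 1_V * 1_W`, the product being `1_{V ∩ W}`. -/
theorem unitSets_union {V W : Set (unitSpace G)} (hV : V ∈ unitSets I) (hW : W ∈ unitSets I) :
    V ∪ W ∈ unitSets I := by
  refine ⟨hV.1.union hW.1, hV.2.1.union hW.2.1, ?_⟩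
  convert (hV.2.2.add hW.2.2).sub (hV.2.2.conv_right hW.2.2.1) using 1
  funext g
  rw [Pi.sub_apply, conv_char_coe_left, Pi.add_apply]
  by_cases hg : g ∈ unitSpace G
  · lift g to unitSpace G using hg
    rw [ranMap_coe]
    by_cases h1 : g ∈ V <;> by_cases h2 : g ∈ W <;> simp [char, h1, h2]
  · simp [char, hg]

/-- The units with a neighbourhood whose characteristic function lies in an ideal form an
invariant set. -/
theorem isInvariant_sUnion_unitSets : IsInvariant (⋃₀ unitSets I) := by
  rintro x ⟨V, ⟨hV, hVc, hVI⟩, hxV⟩ _ ⟨g, rfl, rfl⟩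
  obtain ⟨U, hU, hgU, -⟩ := exists_isCompactBisection isOpen_univ (Set.mem_univ g)
  have hVb := isCompactBisection_coe hV hVc
  have hUV := hU.setMul hVb
  have hP := hUV.setMul hU.preimage_inv
  -- The conjugate `U V U⁻¹` consists of the ranges of arrows of `U` with domain in `V`, so it is a
  -- compact open set of units containing `r(g)`.
  set P := setMul (setMul U (Subtype.val '' V)) (inv ⁻¹' U) with hPdef
  have hsub : P ⊆ Set.range (Subtype.val : unitSpace G → G) := by
    rw [Subtype.range_coe]
    rintro c ⟨d, ⟨a, ha, _, ⟨z, hz, rfl⟩, h⟩, b, hb, h'⟩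
    have e : z = domMap a := by
      refine Subtype.ext ?_
      rw [← ran_eq_of_mem_unitSpace z.2]
      exact h.1.symm
    rw [e] at h
    rw [h.unique (isProd_dom a)] at h'
    -- Injectivity of the domain map on `U` forces the two outer factors to be mutually inverse, so
    -- the product is a unit.
    have e2 : inv b = a := hU.injOn_dom hb ha (by rw [ArrowGroupoid.dom_inv]; exact h'.1.symm)
    rw [← inv_inv b, e2] at h'
    rw [h'.unique (isProd_self_inv a)]
    exact dom_ran a
  have hPI : InIdeal I (char K P) := by
    rw [hPdef, ← conv_char_char hUV.injOn_ran, ← conv_char_char hU.injOn_ran]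
    exact (InIdeal.conv_left hU.char_mem hVI).conv_right hU.preimage_inv.char_mem
  refine ⟨Subtype.val ⁻¹' P, ⟨hP.isOpen.preimage continuous_subtype_val, ?_, ?_⟩, ?_⟩
  · exact (IsInducing.subtypeVal.isCompact_preimage_iff hsub).2 hP.isCompact
  · rwa [Set.image_preimage_eq_of_subset hsub]
  · exact ⟨g, ⟨g, hgU, dom g, ⟨domMap g, hxV, rfl⟩, isProd_dom g⟩, inv g,
      by simpa [inv_inv] using hgU, isProd_self_inv g⟩

theorem isOpen_sUnion_unitSets : IsOpen (⋃₀ unitSets I) := isOpen_sUnion fun _ hV => hV.1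

/-- An ideal containing the characteristic functions of a basis of units is everything. -/
theorem mem_of_sUnion_unitSets_eq_univ (h : ⋃₀ unitSets I = Set.univ) (f : SteinbergAlgebra K G) :
    f ∈ I := by
  obtain ⟨s, hs, hsb, hfs⟩ := exists_finite_cover_of_mem f.2
  have hC : IsCompact (ranMap '' ⋃₀ s : Set (unitSpace G)) :=
    (hs.isCompact_sUnion fun U hU => (hsb U hU).isCompact).image continuous_ranMap
  obtain ⟨V, hV, hCV⟩ : ∃ V ∈ unitSets I, ranMap '' ⋃₀ s ⊆ V := by
    -- Closure under finite unions lets one member of `unitSets I` cover the compact set of ranges;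
    -- its characteristic function is then a left unit for `f`.
    refine hC.induction_on (p := fun C => ∃ V ∈ unitSets I, C ⊆ V) ?_ ?_ ?_ ?_
    · refine ⟨∅, ⟨isOpen_empty, isCompact_empty, ?_⟩, subset_rfl⟩
      convert (show InIdeal I (0 : G → K) from ⟨zero_mem _, I.zero_mem⟩) using 1
      funext g
      simp [char]
    · rintro A B hAB ⟨V, hV, hBV⟩
      exact ⟨V, hV, hAB.trans hBV⟩
    · rintro A B ⟨V, hV, hAV⟩ ⟨W, hW, hBW⟩
      exact ⟨V ∪ W, unitSets_union hV hW, Set.union_subset_union hAV hBW⟩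
    · intro x _
      obtain ⟨V, hV, hx⟩ : x ∈ ⋃₀ unitSets I := by rw [h]; trivial
      exact ⟨V, mem_nhdsWithin_of_mem_nhds (hV.1.mem_nhds hx), V, hV, subset_rfl⟩
  have h1 : InIdeal I (conv (char K (Subtype.val '' V : Set G)) f.1) := hV.2.2.conv_right f.2
  have h2 : conv (char K (Subtype.val '' V : Set G)) f.1 = f.1 := by
    funext g
    rw [conv_char_coe_left]
    by_cases hg : f.1 g = 0
    · rw [hg, mul_zero]
    · have : ranMap g ∈ V := hCV ⟨g, hfs hg, rfl⟩
      simp [char, this]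
  rw [h2] at h1
  exact h1.2

end Simple

/-! ### Minimal and topologically free implies simple, over a field -/

section Field

variable {K : Type v} [Field K] {G : Type u} [ArrowGroupoid G] [TopologicalSpace G] [IsAmple G]
  {I : TwoSidedIdeal (SteinbergAlgebra K G)}

/-- A non-singular function can be translated to take the value `1` on an open set of units,
within the ideal it generates. -/
theorem InIdeal.exists_eq_one_on {f : G → K} (hf : InIdeal I f) (hs : ¬ IsSingular f) :
    ∃ h, InIdeal I h ∧ ∃ V : Set (unitSpace G), IsOpen V ∧ V.Nonempty ∧ ∀ x ∈ V, h x = 1 := by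
  obtain ⟨E, hE, hEd, hEf⟩ := exists_dense_of_mem hf.1
  obtain ⟨g, hg, hgE⟩ := hEd.inter_open_nonempty _ isOpen_interior (Set.nonempty_iff_ne_empty.2 hs)
  have hfg : f g ≠ 0 := interior_subset hg
  obtain ⟨U, hU, hgU, hUsub⟩ := exists_isCompactBisection
    (isOpen_interior (s := {y | f y = f g})) (mem_interior_iff_mem_nhds.2 (hEf g hgE))
  -- On `U` the function is constantly `f g`. Translating by `U⁻¹` carries these values to the units
  -- `a⁻¹ a`, and the scalar normalizes them to 1.
  refine ⟨conv ((f g)⁻¹ • char K (inv ⁻¹' U)) f,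
    hf.conv_left (Submodule.smul_mem _ _ hU.preimage_inv.char_mem), domMap '' U,
    IsEtale.isLocalHomeomorph_dom.isOpenMap _ hU.isOpen, ⟨_, g, hgU, rfl⟩, ?_⟩
  rintro _ ⟨a, ha, rfl⟩
  have hfa : f a = f g := hUsub.trans interior_subset ha
  have hprod : IsProd (inv a) a (domMap a : G) := isProd_inv_self a
  rw [conv_smul_left (fiberFinite_of_mem hU.preimage_inv.char_mem), Pi.smul_apply,
    conv_char_left hU.preimage_inv.injOn_ran f (by simpa [inv_inv] using ha) hprod, hfa, smul_eq_mul, inv_mul_cancel₀ hfg]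

/-- Normalize to a function `h` equal to 1 on an open set of units, then choose there a generic unit
`x`. Near `x` the compression `1_O * h * 1_O` is `1_O`. -/
theorem sUnion_unitSets_nonempty (hG : IsTopologicallyFree G) {f : G → K} (hf : InIdeal I f)
    (hs : ¬ IsSingular f) : (⋃₀ unitSets I).Nonempty := by
  obtain ⟨h, hI, W, hW, hWne, hW1⟩ := hf.exists_eq_one_on hs
  obtain ⟨D, -, hDd, hDh⟩ := exists_dense_locally_unit hG hI.1
  obtain ⟨x, hxW, hxD⟩ := hDd.inter_open_nonempty W hW hWne
  obtain ⟨V, hV, hVh⟩ := hDh x hxD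
  obtain ⟨O, hO, hOc, hxO, hOV⟩ :=
    exists_compactOpen_subset isOpen_interior (mem_interior_iff_mem_nhds.2 hV)
  have hOb := isCompactBisection_coe hO hOc
  refine ⟨x, O, ⟨hO, hOc, ?_⟩, hxO⟩
  convert (hI.conv_left hOb.char_mem).conv_right hOb.char_mem using 1
  funext g
  rw [conv_char_coe_right, conv_char_coe_left]
  by_cases hd : domMap g ∈ O
  · by_cases hr : ranMap g ∈ O
    · rw [hVh g (interior_subset (hOV hd)) (interior_subset (hOV hr)), hW1 x hxW]
      by_cases hg : g ∈ unitSpace G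
      · lift g to unitSpace G using hg
        rw [domMap_coe] at hd
        simp [char, domMap_coe, ranMap_coe, hd]
      · simp [char, hg]
    · have : g ∉ (Subtype.val '' O : Set G) := by
        rintro ⟨z, hz, rfl⟩
        exact hr (by rwa [ranMap_coe])
      rw [char, Set.indicator_of_notMem this]
      simp [char, hr]
  · have : g ∉ (Subtype.val '' O : Set G) := by
      rintro ⟨z, hz, rfl⟩
      exact hd (by rwa [domMap_coe])
    rw [char, Set.indicator_of_notMem this]
    simp [char, hd]

/-- An ideal not contained in the singular ideal is the whole Steinberg algebra, not merely so
modulo singular functions. Non-emptiness of `G` makes the quotient non-zero. -/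
theorem isSimpleRing_essentialAlgebra [Nonempty G] (hm : IsMinimal G)
    (hG : IsTopologicallyFree G) : IsSimpleRing (EssentialAlgebra K G) := by
  refine isSimpleRing_quotient ?_ fun I => ?_
  · obtain ⟨g⟩ := ‹Nonempty G›
    obtain ⟨V, hV, hVc, hgV, -⟩ := exists_compactOpen_subset isOpen_univ (Set.mem_univ (domMap g))
    exact ⟨⟨_, (isCompactBisection_coe hV hVc).char_mem⟩,
      fun h => not_isSingular_char_coe hV ⟨_, hgV⟩ (mem_singularIdeal.1 h)⟩
  · refine or_iff_not_imp_left.2 fun hI => ?_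
    obtain ⟨f, hf, hs⟩ := SetLike.not_le_iff_exists.1 hI
    refine mem_of_sUnion_unitSets_eq_univ
      ((hm _ isOpen_sUnion_unitSets isInvariant_sUnion_unitSets).resolve_left ?_)
    exact (sUnion_unitSets_nonempty hG ⟨f.2, hf⟩ fun h => hs (mem_singularIdeal.2 h)).ne_empty

theorem isSimpleRing_essentialAlgebra_iff [Nonempty G] :
    IsSimpleRing (EssentialAlgebra K G) ↔ IsMinimal G ∧ IsTopologicallyFree G :=
  ⟨fun _ => ⟨isMinimal_of_isSimpleRing (K := K), isTopologicallyFree_of_isSimpleRing (K := K)⟩,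
    fun h => isSimpleRing_essentialAlgebra h.1 h.2⟩

end Field

end EtaleGroupoid

/-! ### The criterion, and independence of the field -/

theorem mainTheorem2 {G : Type u} [EtaleGroupoid.ArrowGroupoid G] [TopologicalSpace G]
    [EtaleGroupoid.IsAmple G] [Nonempty G] :
    (∀ (K : Type v) [Field K],
      IsSimpleRing (EtaleGroupoid.EssentialAlgebra K G) ↔
        EtaleGroupoid.IsMinimal G ∧ EtaleGroupoid.IsTopologicallyFree G) ∧
    (∀ (K : Type v) [Field K] (L : Type w) [Field L],
      IsSimpleRing (EtaleGroupoid.EssentialAlgebra K G) ↔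
        IsSimpleRing (EtaleGroupoid.EssentialAlgebra L G)) := by
  refine ⟨fun K _ => EtaleGroupoid.isSimpleRing_essentialAlgebra_iff, fun K _ L _ => ?_⟩
  rw [EtaleGroupoid.isSimpleRing_essentialAlgebra_iff (K := K),
    EtaleGroupoid.isSimpleRing_essentialAlgebra_iff (K := L)]
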